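/- Let $k\ge 2$, let $\mu_1,\dots,\mu_k\in\mathbb R$ and $\sigma_1,\dots,\sigma_k>0$, and let the best arm $b$ be unique: $\mu_b>\mu_i$ for all $i\ne b$. Let $X_{i,t}\sim\mathcal N(\mu_i,\sigma_i^2)$ ($1\le i\le k$, $t=1,2,\dots$) be independent rewards. The knowledge gradient (KG) algorithm starts from $\theta_{i,1}=0$, $\lambda_{i,1}^2=\infty$ for all $i$. In round $t$ it pulls an arm $I_t=\mathcal I((\theta_{i,t},\lambda_{i,t}^2)_{i\le k})$ that maximizes $$v_{i,t}=\zeta_{i,t}\,f\Bigl(-\frac{|\theta_{i,t}-\max_{j\ne i}\theta_{j,t}|}{\zeta_{i,t}}\Bigr),\qquad \zeta_{i,t}^2=\lambda_{i,t}^2-(\lambda_{i,t}^{-2}+\sigma_i^{-2})^{-1},\qquad f(x)=x\Phi(x)+\phi(x)$$ ($\phi,\Phi$ the standard normal density and distribution function; $v_{i,t}=\infty$ if $\lambda_{i,t}^2=\infty$), where $\mathcal I$ is any fixed measurable selection of a maximizer. It observes $X_{I_t,t}$ and sets, for $i=I_t$, $$\theta_{i,t+1}=\frac{\lambda_{i,t}^{-2}\theta_{i,t}+\sigma_i^{-2}X_{i,t}}{\lambda_{i,t}^{-2}+\sigma_i^{-2}},\qquad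 \lambda_{i,t+1}^2=(\lambda_{i,t}^{-2}+\sigma_i^{-2})^{-1},$$ and leaves $\theta_i,\lambda_i^2$ unchanged for $i\neq I_t$. Let $N_{i,t}=\sum_{s=1}^t\mathbb 1\{I_s=i\}$. Put $\sigma_{\max}=\max_i\sigma_i$, $\sigma_{\min}=\min_i\sigma_i$, $\delta_{\max}=\max_{i_1\ne i_2}|\mu_{i_1}-\mu_{i_2}|$, $d=\mu_b-\max_{j\ne b}\mu_j$, $d_i=\mu_b-\mu_i$, $L=\max\{\ln\frac{27\delta_{\max}^3}{8\sigma_{\min}^4},0\}$, $$q(s)=4\sigma_{\max}k^{-1/8}s^{-1/8}\exp\Bigl\{-\frac{k^{1/4}s^{1/4}}{8\sigma_{\max}^2}\Bigr\},$$ and, for $i\ne b$, $\underline\rho_{i,b,t}=\min\{\underline\rho^{(1)}_{i,b,t},\underline\rho^{(2)}_{i,b,t}\}$, $\overline\rho_{i,b,t}=\max\{\overline\rho^{(1)}_{i,b,t},\overline\rho^{(2)}_{i,b,t}\}$ with $$\underline\rho^{(1)}_{i,b,t}=\frac{d-(\frac34t)^{-1/4}}{\bigl(1+(\frac{3t}{4k})^{-3/4}\bigr)^2\sigma_b}\Bigl(\frac{(d_i+(\frac34t)^{-1/4})^2}{\sigma_i^2}+\frac{16k}{\sqrt{3t}}+\frac{8kL}{3t}\Bigr)^{-1/2},$$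 $$\underline\rho^{(2)}_{i,b,t}=\frac{d-t^{-1/4}}{\bigl(1+(\frac tk)^{-3/4}\bigr)\sigma_b}\Bigl(\frac{(d_i+t^{-1/4})^2}{\sigma_i^2}+\frac{8k}{\sqrt t}+\frac{2kL}{t}\Bigr)^{-1/2},$$ $$\overline\rho^{(1)}_{i,b,t}=\frac{\bigl(1+(\frac tk)^{-3/4}\bigr)\sigma_i}{d_i-t^{-1/4}}\Bigl(\frac{(d+t^{-1/4})^2}{\sigma_b^2}+\frac{8k}{\sqrt t}+\frac{2kL}{t}\Bigr)^{1/2},$$ $$\overline\rho^{(2)}_{i,b,t}=\frac{\bigl(1+(\frac{3t}{4k})^{-3/4}\bigr)^2\sigma_i}{d_i-(\frac34t)^{-1/4}}\Bigl(\frac{(d+(\frac34t)^{-1/4})^2}{\sigma_b^2}+\frac{16k}{\sqrt{3t}}+\frac{8kL}{3t}\Bigr)^{1/2}.$$ Let $T_0$ be the (random) first time such that $N_{i,s}\ge(s/k)^{3/4}$ for all arms $i$ and all $s\ge T_0$. Then there is a non-random $T$ such that for every $t>T$, with probability at least $[1-q(\frac34t)]^k$, one has $t\ge T_0$ and $$\underline\rho_{i,b,s}\le\frac{N_{i,s}}{N_{b,s}}\le\overline\rho_{i,b,s}\qquad\text{for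 all } i\ne b\text{ and all } s\ge t.$$ -/

import Mathlib

open MeasureTheory ProbabilityTheory
open scoped ENNReal

noncomputable section

namespace KnowledgeGradient

/-- The function `f(x) = x Φ(x) + φ(x)`, where `φ` and `Φ` are the density and the distribution
function of the standard normal law. -/
def f (x : ℝ) : ℝ :=
  x * (∫ r in Set.Iic x, gaussianPDFReal 0 1 r) + gaussianPDFReal 0 1 x

/-- A state of knowledge about `k` arms: the posterior means `θ i` (first component) and the
posterior variances `λ i ^ 2` (second component). A variance may be infinite. -/
abbrev Knowledge (k : ℕ) : Type := (Fin k → ℝ) × (Fin k → ℝ≥0∞)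

/-- The non-informative prior: means `0`, variances `∞`. -/
def prior (k : ℕ) : Knowledge k := (fun _ => 0, fun _ => ⊤)

/-- The posterior variance of an arm after one more pull, `(λ⁻² + σ⁻²)⁻¹`, where `l = λ ^ 2` is its
present variance and `σ` the standard deviation of its rewards. -/
def nextVar (σ : ℝ) (l : ℝ≥0∞) : ℝ≥0∞ :=
  (l⁻¹ + (ENNReal.ofReal (σ ^ 2))⁻¹)⁻¹

/-- The posterior mean of an arm after one more pull with reward `x`,
`(λ⁻² θ + σ⁻² x) / (λ⁻² + σ⁻²)`. -/
def nextMean (σ : ℝ) (l : ℝ≥0∞) (θ x : ℝ) : ℝ :=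
  ((l⁻¹).toReal * θ + (σ ^ 2)⁻¹ * x) / ((l⁻¹).toReal + (σ ^ 2)⁻¹)

/-- The Bayesian update of the knowledge when arm `a` is pulled and yields the reward `x`. -/
def update {k : ℕ} (σ : Fin k → ℝ) (S : Knowledge k) (a : Fin k) (x : ℝ) : Knowledge k :=
  (Function.update S.1 a (nextMean (σ a) (S.2 a) (S.1 a) x),
    Function.update S.2 a (nextVar (σ a) (S.2 a)))

/-- `ζ i`, the standard deviation of the change of the posterior mean of arm `i` caused by one
pull: the square root of `λ i ^ 2` minus its value after a pull. It is `∞` for a variance `∞`. -/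
def zeta {k : ℕ} (σ : Fin k → ℝ) (S : Knowledge k) (i : Fin k) : ℝ≥0∞ :=
  (S.2 i - nextVar (σ i) (S.2 i)) ^ (1 / 2 : ℝ)

/-- The knowledge gradient `v i = ζ i * f (- |θ i - max_{j ≠ i} θ j| / ζ i)` of arm `i`. It is `∞`
for an arm of infinite variance. -/
def kgValue {k : ℕ} (σ : Fin k → ℝ) (S : Knowledge k) (i : Fin k) : ℝ≥0∞ :=
  zeta σ S i * ENNReal.ofReal
    (f (-(ENNReal.ofReal |S.1 i - ⨆ j : {j : Fin k // j ≠ i}, S.1 j| / zeta σ S i).toReal))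

/-- `rule` is a knowledge gradient sampling rule: a measurable map that sends every state of
knowledge to an arm of maximal knowledge gradient, with ties broken in any way. -/
def IsKGRule {k : ℕ} (σ : Fin k → ℝ) (rule : Knowledge k → Fin k) : Prop :=
  Measurable rule ∧ ∀ S i, kgValue σ S i ≤ kgValue σ S (rule S)

/-- The knowledge after the first `n` rounds, that is, before round `n + 1`. Here `x i n` is the
reward that arm `i` gives if it is pulled in round `n + 1`. -/
def knowledge {k : ℕ} (σ : Fin k → ℝ) (rule : Knowledge k → Fin k) (x : Fin k → ℕ → ℝ) :
    ℕ → Knowledge k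
  | 0 => prior k
  | n + 1 =>
    update σ (knowledge σ rule x n) (rule (knowledge σ rule x n))
      (x (rule (knowledge σ rule x n)) n)

/-- The arm pulled in round `n + 1`. -/
def pulled {k : ℕ} (σ : Fin k → ℝ) (rule : Knowledge k → Fin k) (x : Fin k → ℕ → ℝ) (n : ℕ) :
    Fin k :=
  rule (knowledge σ rule x n)

/-- `N i t`, the number of pulls of arm `i` in the rounds `1, …, t`. -/
def pulls {k : ℕ} (σ : Fin k → ℝ) (rule : Knowledge k → Fin k) (x : Fin k → ℕ → ℝ) (i : Fin k)
    (t : ℕ) : ℕ :=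
  ((Finset.range t).filter (fun n => pulled σ rule x n = i)).card

/-- `σ_max`. -/
def sigmaMax {k : ℕ} (σ : Fin k → ℝ) : ℝ := ⨆ i, σ i

/-- `σ_min`. -/
def sigmaMin {k : ℕ} (σ : Fin k → ℝ) : ℝ := ⨅ i, σ i

/-- `δ_max`, the largest `|μ i₁ - μ i₂|` with `i₁ ≠ i₂`. -/
def deltaMax {k : ℕ} (μ : Fin k → ℝ) : ℝ :=
  ⨆ p : {p : Fin k × Fin k // p.1 ≠ p.2}, |μ p.1.1 - μ p.1.2|

/-- `max_{j ≠ b} μ j`. -/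
def second {k : ℕ} (μ : Fin k → ℝ) (b : Fin k) : ℝ := ⨆ j : {j : Fin k // j ≠ b}, μ j

/-- `max {ln (27 δ_max ^ 3 / (8 σ_min ^ 4)), 0}`. -/
def logTerm {k : ℕ} (μ σ : Fin k → ℝ) : ℝ :=
  max (Real.log (27 * deltaMax μ ^ 3 / (8 * sigmaMin σ ^ 4))) 0

/-- `q(s)`. -/
def q {k : ℕ} (σ : Fin k → ℝ) (s : ℝ) : ℝ :=
  4 * sigmaMax σ * (k : ℝ) ^ (-(1 / 8) : ℝ) * s ^ (-(1 / 8) : ℝ) *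
    Real.exp (-((k : ℝ) ^ (1 / 4 : ℝ) * s ^ (1 / 4 : ℝ) / (8 * sigmaMax σ ^ 2)))

/-- The first lower bound. -/
def rhoLow1 {k : ℕ} (μ σ : Fin k → ℝ) (i b : Fin k) (t : ℝ) : ℝ :=
  (μ b - second μ b - (3 / 4 * t) ^ (-(1 / 4) : ℝ)) /
      ((1 + (3 * t / (4 * k)) ^ (-(3 / 4) : ℝ)) ^ 2 * σ b) *
    ((μ b - μ i + (3 / 4 * t) ^ (-(1 / 4) : ℝ)) ^ 2 / σ i ^ 2 + 16 * k / √(3 * t) +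
      8 * k * logTerm μ σ / (3 * t)) ^ (-(1 / 2) : ℝ)

/-- The second lower bound. -/
def rhoLow2 {k : ℕ} (μ σ : Fin k → ℝ) (i b : Fin k) (t : ℝ) : ℝ :=
  (μ b - second μ b - t ^ (-(1 / 4) : ℝ)) / ((1 + (t / k) ^ (-(3 / 4) : ℝ)) * σ b) *
    ((μ b - μ i + t ^ (-(1 / 4) : ℝ)) ^ 2 / σ i ^ 2 + 8 * k / √t +
      2 * k * logTerm μ σ / t) ^ (-(1 / 2) : ℝ)

/-- The first upper bound. -/
def rhoUp1 {k : ℕ} (μ σ : Fin k → ℝ) (i b : Fin k) (t : ℝ) : ℝ :=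
  (1 + (t / k) ^ (-(3 / 4) : ℝ)) * σ i / (μ b - μ i - t ^ (-(1 / 4) : ℝ)) *
    ((μ b - second μ b + t ^ (-(1 / 4) : ℝ)) ^ 2 / σ b ^ 2 + 8 * k / √t +
      2 * k * logTerm μ σ / t) ^ (1 / 2 : ℝ)

/-- The second upper bound. -/
def rhoUp2 {k : ℕ} (μ σ : Fin k → ℝ) (i b : Fin k) (t : ℝ) : ℝ :=
  (1 + (3 * t / (4 * k)) ^ (-(3 / 4) : ℝ)) ^ 2 * σ i /
      (μ b - μ i - (3 / 4 * t) ^ (-(1 / 4) : ℝ)) *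
    ((μ b - second μ b + (3 / 4 * t) ^ (-(1 / 4) : ℝ)) ^ 2 / σ b ^ 2 + 16 * k / √(3 * t) +
      8 * k * logTerm μ σ / (3 * t)) ^ (1 / 2 : ℝ)

/-- The lower bound for the ratio of the numbers of pulls of the arms `i` and `b`. -/
def rhoLow {k : ℕ} (μ σ : Fin k → ℝ) (i b : Fin k) (t : ℝ) : ℝ :=
  min (rhoLow1 μ σ i b t) (rhoLow2 μ σ i b t)

/-- The upper bound for the ratio of the numbers of pulls of the arms `i` and `b`. -/
def rhoUp {k : ℕ} (μ σ : Fin k → ℝ) (i b : Fin k) (t : ℝ) : ℝ :=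
  max (rhoUp1 μ σ i b t) (rhoUp2 μ σ i b t)

end KnowledgeGradient

end

/-!
Since `(1 - q) ^ k ≤ 1 - q` for `0 ≤ q ≤ 1` and `q` decays only like `exp (-C * t ^ (1 / 4))`, it
suffices that the stated bounds fail from time `t` on with a probability of smaller order. The
argument has a deterministic part and two exponential probability bounds.

*Comparison of knowledge gradients.* Write `ζ i = σ i / √(n (n + 1))` for an arm with `n` pulls,
`gap θ i` for the distance of its posterior mean from the best other one, and `x i = gap θ i / ζ i`,
so that the knowledge gradient is `ζ i * f (-x i)`. From `f x = E (x - Z)⁺`, `Z` standard normal, it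
follows that `f (-(x + 1)) ≤ exp (-x - 1 / 2) * f (-x)`, so if `i` is pulled and `ζ i` is not
exponentially larger than `ζ j`, then `x i ≤ x j + 1` (`gap_mul_le_of_pulled`). There are no
logarithmic corrections. Applied at the last pull of an arm before time `s`, this gives
`n i * gap μ i / σ i ≈ n j * gap μ j / σ j`, that is, the ratio bounds
(`eventually_pulls_ratio`), once all numbers of pulls grow linearly and the posterior means are close
to the true means.

*Concentration.* Up to time `s` every posterior mean is within `s ^ (1 / 7) / √n` of the true mean,
except with probability about `exp (-c * s ^ (2 / 7))` (`measure_not_concentrated_le`). Rewards are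
selected adaptively, so this uses an exponential supermartingale (`measure_le_sum_le`).

*Linear growth.* Some arm has at least `s / k` pulls. When it is pulled late, the best of the other
arms, its partner, has of the order of `s` pulls too, since a smaller gap and a larger `ζ` would give
it a larger knowledge gradient. If the means of the two arms differ, their gap is of constant order,
and an arm with few pulls would have been preferred. If the means are equal, then the best arm is
underestimated, by concentration it has `O (s ^ (2 / 7))` pulls, and comparison with it shows that
the two posterior means differ by only `O (s ^ (-5 / 7))` (`pulls_ge_or_tied`). This would have to
happen in a positive fraction of all rounds for some pair of arms with equal means. The difference of
their posterior means behaves like a martingale that moves by about `1 / s` per round, and its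
occupation time near `0` is controlled by the supermartingale `exp (-δ * √(1 + (D / η) ^ 2))`, where
`D` is the difference and `η` the size of the window. Such a long stay in the window has probability
at most `exp (-c * s ^ (3 / 7))` (`exists_measure_tied_le`).

The exponent `1 / 7` in the concentration bound could be any `β` in `(1 / 8, 1 / 6)`: the failure
probability `exp (-c * s ^ (2 * β))` has to beat `q`, and the gain `s ^ (1 - 4 * β)` in the last step
has to dominate the drift `s ^ (1 / 2 - β)`.
-/

namespace KnowledgeGradient

open Filter Topology

/-! ### The function `f` -/

lemma gaussianPDFReal_std (x : ℝ) :
    gaussianPDFReal 0 1 x = (√(2 * Real.pi))⁻¹ * Real.exp (-x ^ 2 / 2) := by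
  simp [gaussianPDFReal]

lemma hasDerivAt_neg_gaussianPDFReal (x : ℝ) :
    HasDerivAt (fun r => -gaussianPDFReal 0 1 r) (x * gaussianPDFReal 0 1 x) x := by
  simp only [gaussianPDFReal_std]
  have h : HasDerivAt (fun r : ℝ => -r ^ 2 / 2) (-x) x := by
    have := ((hasDerivAt_pow 2 x).neg).div_const 2
    exact this.congr_deriv (by push_cast; ring)
  have := (h.exp.const_mul (√(2 * Real.pi))⁻¹).neg
  exact this.congr_deriv (by ring)

lemma integrable_mul_gaussianPDFReal : Integrable (fun r => r * gaussianPDFReal 0 1 r) := by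
  have h := (integrable_mul_exp_neg_mul_sq (b := 1 / 2) (by norm_num)).const_mul (√(2 * Real.pi))⁻¹
  refine h.congr (ae_of_all _ fun r => ?_)
  simp only [gaussianPDFReal_std]
  ring_nf

lemma tendsto_gaussianPDFReal_atBot :
    Tendsto (fun r => -gaussianPDFReal 0 1 r) atBot (𝓝 0) := by
  simp only [gaussianPDFReal_std]
  have h : Tendsto (fun r : ℝ => -r ^ 2 / 2) atBot atBot := by
    have h2 : Tendsto (fun r : ℝ => r ^ 2) atBot atTop := by
      have := (tendsto_pow_atTop (α := ℝ) (n := 2) (by norm_num)).comp tendsto_neg_atBot_atTop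
      refine this.congr fun r => by simp
    have h3 := (tendsto_neg_atTop_atBot.comp h2).atBot_div_const (r := (2 : ℝ)) (by norm_num)
    exact h3
  have := ((Real.tendsto_exp_atBot.comp h).const_mul (√(2 * Real.pi))⁻¹).neg
  simpa using this

lemma integral_Iic_mul_gaussianPDFReal (x : ℝ) :
    ∫ r in Set.Iic x, r * gaussianPDFReal 0 1 r = -gaussianPDFReal 0 1 x := by
  have := integral_Iic_of_hasDerivAt_of_tendsto (a := x)
    (hasDerivAt_neg_gaussianPDFReal x).continuousAt.continuousWithinAt
    (fun y _ => hasDerivAt_neg_gaussianPDFReal y) integrable_mul_gaussianPDFReal.integrableOn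
    tendsto_gaussianPDFReal_atBot
  simpa using this

lemma integrable_posPart_mul_gaussianPDFReal (x : ℝ) :
    Integrable (fun r => max (x - r) 0 * gaussianPDFReal 0 1 r) := by
  have h : Integrable (fun r => (x - r) * gaussianPDFReal 0 1 r) := by
    have := ((integrable_gaussianPDFReal 0 1).const_mul x).sub integrable_mul_gaussianPDFReal
    refine this.congr (ae_of_all _ fun r => ?_)
    simp only [Pi.sub_apply]; ring
  refine h.pos_part.congr (ae_of_all _ fun r => ?_)
  have := gaussianPDFReal_nonneg 0 1 r
  simp only [max_mul_of_nonneg _ _ this, zero_mul]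

/-- `f x` is the expectation of the positive part of `x - r` for a standard normal `r`; all
properties of `f` are read off this formula. -/
lemma f_eq_integral (x : ℝ) : f x = ∫ r, max (x - r) 0 * gaussianPDFReal 0 1 r := by
  have h : ∀ r, max (x - r) 0 * gaussianPDFReal 0 1 r =
      Set.indicator (Set.Iic x) (fun r => x * gaussianPDFReal 0 1 r - r * gaussianPDFReal 0 1 r) r := by
    intro r
    by_cases hr : r ≤ x
    · rw [Set.indicator_of_mem (by exact hr), max_eq_left (by linarith)]; ring
    · rw [Set.indicator_of_notMem (by exact hr), max_eq_right (by linarith), zero_mul]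
  simp_rw [h]
  rw [integral_indicator measurableSet_Iic, integral_sub
    ((integrable_gaussianPDFReal 0 1).const_mul x).integrableOn
    integrable_mul_gaussianPDFReal.integrableOn, integral_Iic_mul_gaussianPDFReal,
    integral_const_mul, f]
  ring

lemma f_mono : Monotone f := by
  intro x y hxy
  rw [f_eq_integral, f_eq_integral]
  refine integral_mono (integrable_posPart_mul_gaussianPDFReal x)
    (integrable_posPart_mul_gaussianPDFReal y) fun r => ?_
  exact mul_le_mul_of_nonneg_right (max_le_max (by linarith) le_rfl) (gaussianPDFReal_nonneg 0 1 r)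

lemma f_pos (x : ℝ) : 0 < f x := by
  rw [f_eq_integral, integral_pos_iff_support_of_nonneg
    (fun r => mul_nonneg (le_max_right _ _) (gaussianPDFReal_nonneg 0 1 r))
    (integrable_posPart_mul_gaussianPDFReal x)]
  have : Set.Iio x ⊆ Function.support fun r => max (x - r) 0 * gaussianPDFReal 0 1 r := by
    intro r hr
    have hr' : r < x := hr
    have := gaussianPDFReal_pos 0 1 r (by norm_num)
    simp only [Function.mem_support]
    rw [max_eq_left (by linarith)]
    exact (mul_pos (by linarith) this).ne'
  exact lt_of_lt_of_le (by simp) (measure_mono this)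

/-- Moving one unit away from `0` on the negative half-line costs `f` a factor that is at least
exponentially small. This keeps logarithmic terms out of the comparison of knowledge gradients. -/
lemma f_neg_add_one_le (x : ℝ) : f (-(x + 1)) ≤ Real.exp (-x - 1 / 2) * f (-x) := by
  rw [f_eq_integral, f_eq_integral, ← integral_const_mul,
    ← integral_sub_right_eq_self (fun r => max (-(x + 1) - r) 0 * gaussianPDFReal 0 1 r) 1]
  refine integral_mono ((integrable_posPart_mul_gaussianPDFReal _).comp_sub_right 1)
    ((integrable_posPart_mul_gaussianPDFReal _).const_mul _) fun r => ?_
  have e : -(x + 1) - (r - 1) = -x - r := by ring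
  simp only [e]
  by_cases hr : r ≤ -x
  · rw [max_eq_left (by linarith), mul_left_comm]
    refine mul_le_mul_of_nonneg_left ?_ (by linarith)
    rw [gaussianPDFReal_std, gaussianPDFReal_std, mul_left_comm, ← Real.exp_add]
    gcongr
    nlinarith
  · rw [max_eq_right (by linarith)]; simp

/-- If an arm with parameters `(z', x')` has at most the knowledge gradient of one with parameters
`(z, x)` and `z` is not much larger than `z'`, then `x` exceeds `x'` by at most `1`. -/
lemma le_add_one_of_mul_f_le {z z' x x' : ℝ} (hz' : 0 < z') (hx : z ≤ Real.exp x' * z')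
    (h : z' * f (-x') ≤ z * f (-x)) : x ≤ x' + 1 := by
  by_contra! hlt
  have h1 : f (-x) ≤ Real.exp (-x' - 1 / 2) * f (-x') :=
    (f_mono (by linarith)).trans (f_neg_add_one_le x')
  have h2 : z * f (-x) ≤ Real.exp x' * z' * (Real.exp (-x' - 1 / 2) * f (-x')) :=
    mul_le_mul hx h1 (f_pos _).le (by positivity)
  have h3 : Real.exp x' * z' * (Real.exp (-x' - 1 / 2) * f (-x')) =
      Real.exp (-1 / 2) * (z' * f (-x')) := by
    rw [show Real.exp x' * z' * (Real.exp (-x' - 1 / 2) * f (-x')) =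
      (Real.exp x' * Real.exp (-x' - 1 / 2)) * (z' * f (-x')) by ring, ← Real.exp_add]
    ring_nf
  have h4 : Real.exp (-1 / 2) < 1 := by rw [← Real.exp_zero]; exact Real.exp_lt_exp.2 (by norm_num)
  have h5 : 0 < z' * f (-x') := mul_pos hz' (f_pos _)
  nlinarith

/-- For a fixed gap the knowledge gradient increases strictly with `ζ`. -/
lemma le_of_mul_f_le {z z' g g' : ℝ} (hz : 0 < z) (hg : 0 ≤ g) (hgg : g' ≤ g)
    (h : z' * f (-(g' / z')) ≤ z * f (-(g / z))) : z' ≤ z := by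
  by_contra! hlt
  have hz' : 0 < z' := hz.trans hlt
  have h1 : f (-(g / z)) ≤ f (-(g' / z')) := f_mono (by
    have h2 : g' / z' ≤ g / z' := by gcongr
    have h3 : g / z' ≤ g / z := by gcongr
    linarith)
  have := f_pos (-(g / z))
  nlinarith

/-! ### The state of knowledge in terms of numbers of pulls -/

section Trajectory

variable {k : ℕ} {σ : Fin k → ℝ} {rule : Knowledge k → Fin k} {x : Fin k → ℕ → ℝ}

/-- The posterior mean `θ i` of arm `i` after `n` rounds. -/
noncomputable def mean (σ : Fin k → ℝ) (rule : Knowledge k → Fin k) (x : Fin k → ℕ → ℝ)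
    (i : Fin k) (n : ℕ) : ℝ :=
  (knowledge σ rule x n).1 i

/-- The distance of the posterior mean of arm `i` from the best posterior mean of the other arms. -/
noncomputable def gap (θ : Fin k → ℝ) (i : Fin k) : ℝ := |θ i - ⨆ j : {j : Fin k // j ≠ i}, θ j|

/-- The real number `ζ` of an arm with standard deviation `s` and `n ≥ 1` pulls. -/
noncomputable def sdStep (s : ℝ) (n : ℕ) : ℝ := s / √(n * (n + 1))

@[simp] lemma pulls_zero (i : Fin k) : pulls σ rule x i 0 = 0 := by simp [pulls]

lemma pulls_succ (i : Fin k) (n : ℕ) :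
    pulls σ rule x i (n + 1) = pulls σ rule x i n + if pulled σ rule x n = i then 1 else 0 := by
  unfold pulls
  rw [Finset.range_add_one, Finset.filter_insert]
  split_ifs with h
  · rw [Finset.card_insert_of_notMem (by simp)]
  · rfl

lemma pulls_mono (i : Fin k) : Monotone (pulls σ rule x i) :=
  monotone_nat_of_le_succ fun n => by rw [pulls_succ]; omega

lemma pulls_le (i : Fin k) (n : ℕ) : pulls σ rule x i n ≤ n := by
  simpa [pulls] using Finset.card_filter_le (Finset.range n) (fun m => pulled σ rule x m = i)

lemma sum_pulls (n : ℕ) : ∑ i, pulls σ rule x i n = n := by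
  induction n with
  | zero => simp
  | succ n ih => simp [pulls_succ, Finset.sum_add_distrib, ih]

lemma knowledge_succ_snd (i : Fin k) (n : ℕ) :
    (knowledge σ rule x (n + 1)).2 i = if pulled σ rule x n = i then
      nextVar (σ i) ((knowledge σ rule x n).2 i) else (knowledge σ rule x n).2 i := by
  simp only [knowledge, update, pulled, Function.update_apply]
  by_cases h : rule (knowledge σ rule x n) = i
  · simp [h]
  · simp [h, Ne.symm h]

lemma knowledge_snd (i : Fin k) (n : ℕ) :
    (knowledge σ rule x n).2 i =
      ((pulls σ rule x i n : ℝ≥0∞) * (ENNReal.ofReal (σ i ^ 2))⁻¹)⁻¹ := by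
  induction n with
  | zero => simp [knowledge, prior]
  | succ n ih =>
    rw [knowledge_succ_snd, pulls_succ, ih]
    split_ifs with h
    · simp [nextVar, add_mul]
    · simp

lemma mean_succ (hσ : ∀ i, 0 < σ i) (i : Fin k) (n : ℕ) :
    mean σ rule x i (n + 1) = if pulled σ rule x n = i then
      mean σ rule x i n + (x i n - mean σ rule x i n) / (pulls σ rule x i n + 1)
      else mean σ rule x i n := by
  have hs := hσ i
  simp only [mean, knowledge, update, pulled, Function.update_apply]
  by_cases h : rule (knowledge σ rule x n) = i
  · subst h
    simp only [if_true, nextMean, knowledge_snd]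
    have e : ((((pulls σ rule x (rule (knowledge σ rule x n)) n : ℝ≥0∞) *
        (ENNReal.ofReal (σ (rule (knowledge σ rule x n)) ^ 2))⁻¹)⁻¹)⁻¹).toReal =
        pulls σ rule x (rule (knowledge σ rule x n)) n *
          (σ (rule (knowledge σ rule x n)) ^ 2)⁻¹ := by
      rw [inv_inv, ENNReal.toReal_mul, ENNReal.toReal_inv, ENNReal.toReal_ofReal (by positivity)]
      simp
    rw [e]
    field_simp
    ring
  · simp [h, Ne.symm h]

/-- The posterior mean is the sample mean of the rewards observed so far. -/
lemma pulls_mul_mean_sub (hσ : ∀ i, 0 < σ i) (m : ℝ) (i : Fin k) (n : ℕ) :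
    pulls σ rule x i n * (mean σ rule x i n - m) =
      ∑ u ∈ Finset.range n, if pulled σ rule x u = i then x i u - m else 0 := by
  induction n with
  | zero => simp
  | succ n ih =>
    rw [Finset.sum_range_succ, ← ih, mean_succ hσ, pulls_succ]
    split_ifs with h
    · push_cast
      field_simp
      ring
    · simp

/-! ### The knowledge gradient of an arm -/

lemma kgValue_of_pulls_eq_zero (i : Fin k) (n : ℕ) (h : pulls σ rule x i n = 0) :
    kgValue σ (knowledge σ rule x n) i = ⊤ := by
  have hl : (knowledge σ rule x n).2 i = ⊤ := by simp [knowledge_snd, h]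
  have hz : zeta σ (knowledge σ rule x n) i = ⊤ := by
    simp [zeta, hl, nextVar, ENNReal.top_sub]
  simp [kgValue, hz, ENNReal.top_mul, f_pos]

lemma zeta_of_pulls_pos (hσ : ∀ i, 0 < σ i) (i : Fin k) (n : ℕ) (h : 0 < pulls σ rule x i n) :
    zeta σ (knowledge σ rule x n) i = ENNReal.ofReal (sdStep (σ i) (pulls σ rule x i n)) := by
  have hs := hσ i
  set N := pulls σ rule x i n
  have hN : (0 : ℝ) < N := by exact_mod_cast h
  have hinv : ∀ M : ℕ, 0 < M → ((M : ℝ≥0∞) * (ENNReal.ofReal (σ i ^ 2))⁻¹)⁻¹ =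
      ENNReal.ofReal (σ i ^ 2 / M) := by
    intro M hM
    have hM' : (0 : ℝ) < M := by exact_mod_cast hM
    rw [← ENNReal.ofReal_natCast, ← ENNReal.ofReal_inv_of_pos (by positivity),
      ← ENNReal.ofReal_mul (by positivity), ← ENNReal.ofReal_inv_of_pos (by positivity)]
    congr 1
    field_simp
  have h2 : nextVar (σ i) ((knowledge σ rule x n).2 i) = ENNReal.ofReal (σ i ^ 2 / (N + 1)) := by
    rw [knowledge_snd, nextVar, inv_inv]
    have := hinv (N + 1) (by omega)
    push_cast at this
    rw [← this, add_mul, one_mul]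
  rw [zeta, h2, knowledge_snd, hinv N h, ← ENNReal.ofReal_sub _ (by positivity),
    ENNReal.ofReal_rpow_of_nonneg _ (by norm_num), ← Real.sqrt_eq_rpow, sdStep]
  · congr 1
    rw [show σ i ^ 2 / N - σ i ^ 2 / (N + 1) = σ i ^ 2 / (N * (N + 1)) by field_simp; ring,
      Real.sqrt_div (by positivity), Real.sqrt_sq hs.le]
  · rw [sub_nonneg]
    gcongr
    linarith

lemma sdStep_pos {s : ℝ} (hs : 0 < s) {n : ℕ} (hn : 0 < n) : 0 < sdStep s n := by
  have : (0 : ℝ) < n := by exact_mod_cast hn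
  unfold sdStep
  positivity

lemma kgValue_of_pulls_pos (hσ : ∀ i, 0 < σ i) (i : Fin k) (n : ℕ)
    (h : 0 < pulls σ rule x i n) :
    kgValue σ (knowledge σ rule x n) i =
      ENNReal.ofReal (sdStep (σ i) (pulls σ rule x i n) *
        f (-(gap (fun j => mean σ rule x j n) i / sdStep (σ i) (pulls σ rule x i n)))) := by
  have hp := sdStep_pos (hσ i) h
  rw [kgValue, zeta_of_pulls_pos hσ i n h, ENNReal.ofReal_mul hp.le,
    ← ENNReal.ofReal_div_of_pos hp, ENNReal.toReal_ofReal (by positivity)]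
  rfl

/-- Arms without pulls come first: once the pulled arm has been pulled before, so has every arm. -/
lemma pulls_pos_of_pulled (hrule : IsKGRule σ rule) (hσ : ∀ i, 0 < σ i) {n : ℕ}
    (h : 0 < pulls σ rule x (pulled σ rule x n) n) (j : Fin k) : 0 < pulls σ rule x j n := by
  by_contra hj
  have h1 := hrule.2 (knowledge σ rule x n) j
  rw [kgValue_of_pulls_eq_zero j n (by omega)] at h1
  have h2 := kgValue_of_pulls_pos hσ (pulled σ rule x n) n h
  change _ ≤ kgValue σ (knowledge σ rule x n) (pulled σ rule x n) at h1
  rw [h2] at h1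
  exact absurd h1 (by simp)

/-- The pulled arm has the largest knowledge gradient, in terms of real numbers. -/
lemma kg_le_of_pulled (hrule : IsKGRule σ rule) (hσ : ∀ i, 0 < σ i) {n : ℕ} {i : Fin k}
    (hi : pulled σ rule x n = i) (h : 0 < pulls σ rule x i n) (j : Fin k) :
    sdStep (σ j) (pulls σ rule x j n) *
        f (-(gap (fun j => mean σ rule x j n) j / sdStep (σ j) (pulls σ rule x j n))) ≤
      sdStep (σ i) (pulls σ rule x i n) *
        f (-(gap (fun j => mean σ rule x j n) i / sdStep (σ i) (pulls σ rule x i n))) := by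
  subst hi
  have hj := pulls_pos_of_pulled hrule hσ h j
  have h1 := hrule.2 (knowledge σ rule x n) j
  have h2 := kgValue_of_pulls_pos hσ (pulled σ rule x n) n h
  change _ ≤ kgValue σ (knowledge σ rule x n) (pulled σ rule x n) at h1
  rw [kgValue_of_pulls_pos hσ j n hj, h2] at h1
  exact (ENNReal.ofReal_le_ofReal_iff
    (mul_nonneg (sdStep_pos (hσ _) h).le (f_pos _).le)).1 h1

/-! ### Bounds for `ζ` -/

lemma sdStep_le {s : ℝ} (hs : 0 < s) {n : ℕ} (hn : 0 < n) : sdStep s n ≤ s / n := by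
  have : (0 : ℝ) < n := by exact_mod_cast hn
  unfold sdStep
  gcongr
  apply Real.le_sqrt_of_sq_le
  nlinarith

lemma le_sdStep {s : ℝ} (hs : 0 < s) {n : ℕ} (hn : 0 < n) : s / (n + 1) ≤ sdStep s n := by
  have : (0 : ℝ) < n := by exact_mod_cast hn
  unfold sdStep
  gcongr
  rw [Real.sqrt_le_left (by positivity)]
  nlinarith

/-! ### Gaps -/

lemma le_iSup_ne (θ : Fin k → ℝ) {i j : Fin k} (h : j ≠ i) :
    θ j ≤ ⨆ j : {j : Fin k // j ≠ i}, θ j :=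
  le_ciSup (f := fun j : {j : Fin k // j ≠ i} => θ j) (Set.finite_range _).bddAbove ⟨j, h⟩

/-- Every arm has a partner: the best of the other arms. -/
lemma exists_iSup_ne_eq (hk : 2 ≤ k) (θ : Fin k → ℝ) (i : Fin k) :
    ∃ l, l ≠ i ∧ (⨆ j : {j : Fin k // j ≠ i}, θ j) = θ l := by
  have : Nontrivial (Fin k) := Fin.nontrivial_iff_two_le.2 hk
  obtain ⟨j, hj⟩ := exists_ne i
  have : Nonempty {j : Fin k // j ≠ i} := ⟨⟨j, hj⟩⟩
  obtain ⟨l, hl⟩ := exists_eq_ciSup_of_finite (f := fun j : {j : Fin k // j ≠ i} => θ j)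
  exact ⟨l, l.2, hl.symm⟩

lemma gap_nonneg (θ : Fin k → ℝ) (i : Fin k) : 0 ≤ gap θ i := abs_nonneg _

lemma gap_eq_of_forall_le {θ : Fin k → ℝ} {i l : Fin k} (hl : l ≠ i)
    (h : ∀ j, j ≠ i → θ j ≤ θ l) : gap θ i = |θ i - θ l| := by
  have : Nonempty {j : Fin k // j ≠ i} := ⟨⟨l, hl⟩⟩
  have h1 : (⨆ j : {j : Fin k // j ≠ i}, θ j) = θ l :=
    le_antisymm (ciSup_le fun j => h j j.2) (le_iSup_ne θ hl)
  rw [gap, h1]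

/-- The gap of the partner `l` of an arm `i` is at most the gap of `i`. -/
lemma gap_partner_le {θ : Fin k → ℝ} {i l : Fin k} (hl : l ≠ i)
    (h : ∀ j, j ≠ i → θ j ≤ θ l) : gap θ l ≤ gap θ i := by
  rw [gap_eq_of_forall_le hl h, gap]
  have : Nonempty {j : Fin k // j ≠ l} := ⟨⟨i, hl.symm⟩⟩
  have h1 := le_iSup_ne θ hl.symm
  have h2 : (⨆ j : {j : Fin k // j ≠ l}, θ j) ≤ max (θ i) (θ l) := by
    refine ciSup_le fun j => ?_
    by_cases hj : (j : Fin k) = i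
    · rw [hj]; exact le_max_left _ _
    · exact (h j hj).trans (le_max_right _ _)
  rcases le_total (θ i) (θ l) with hil | hil
  · rw [max_eq_right hil] at h2
    rw [abs_of_nonneg (by linarith), abs_of_nonpos (by linarith)]; linarith
  · rw [max_eq_left hil] at h2
    rw [abs_of_nonpos (by linarith), abs_of_nonneg (by linarith)]; linarith

/-- All arms except `i` and its partner are measured against the better of these two. -/
lemma gap_eq_max_sub {θ : Fin k → ℝ} {i l j : Fin k}
    (h : ∀ j, j ≠ i → θ j ≤ θ l) (hji : j ≠ i) (hjl : j ≠ l) :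
    gap θ j = max (θ i) (θ l) - θ j := by
  have : Nonempty {m : Fin k // m ≠ j} := ⟨⟨i, hji.symm⟩⟩
  have h1 : (⨆ m : {m : Fin k // m ≠ j}, θ m) = max (θ i) (θ l) := by
    refine le_antisymm (ciSup_le fun m => ?_)
      (max_le (le_iSup_ne θ hji.symm) (le_iSup_ne θ hjl.symm))
    by_cases hm : (m : Fin k) = i
    · rw [hm]; exact le_max_left _ _
    · exact (h m hm).trans (le_max_right _ _)
  rw [gap, h1, abs_sub_comm, abs_of_nonneg]
  exact sub_nonneg.2 ((h j hji).trans (le_max_right _ _))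

end Trajectory

/-! ### Consequences of a pull for the numbers of pulls -/

section Growth

variable {k : ℕ} {μ σ : Fin k → ℝ} {rule : Knowledge k → Fin k} {x : Fin k → ℕ → ℝ}

/-- If arm `i` is pulled although arm `j` has a comparable or larger `ζ`, then the standardized gap
of `i` exceeds that of `j` by at most a constant. -/
lemma gap_mul_le_of_pulled (hrule : IsKGRule σ rule) (hσ : ∀ i, 0 < σ i) {n : ℕ} {i : Fin k}
    (hi : pulled σ rule x n = i) (h : 0 < pulls σ rule x i n) (j : Fin k)
    (hij : σ i / pulls σ rule x i n ≤
      Real.exp (gap (fun l => mean σ rule x l n) j * pulls σ rule x j n / σ j) *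
        (σ j / (pulls σ rule x j n + 1))) :
    gap (fun l => mean σ rule x l n) i * pulls σ rule x i n / σ i ≤
      gap (fun l => mean σ rule x l n) j * (pulls σ rule x j n + 1) / σ j + 1 := by
  have hj : 0 < pulls σ rule x j n := by
    subst hi; exact pulls_pos_of_pulled hrule hσ h j
  have key := kg_le_of_pulled hrule hσ hi h j
  set N := pulls σ rule x i n
  set M := pulls σ rule x j n
  set G := gap (fun l => mean σ rule x l n) i
  set H := gap (fun l => mean σ rule x l n) j
  have hG : 0 ≤ G := gap_nonneg _ _
  have hH : 0 ≤ H := gap_nonneg _ _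
  have hN : (0 : ℝ) < N := by exact_mod_cast h
  have hM : (0 : ℝ) < M := by exact_mod_cast hj
  have hsi := hσ i
  have hsj := hσ j
  have zi := sdStep_pos hsi h
  have zj := sdStep_pos hsj hj
  have e1 : G * N / σ i ≤ G / sdStep (σ i) N := by
    rw [le_div_iff₀ zi]
    calc G * N / σ i * sdStep (σ i) N ≤ G * N / σ i * (σ i / N) := by
          gcongr; exact sdStep_le hsi h
      _ = G := by field_simp
  have e2 : H / sdStep (σ j) M ≤ H * (M + 1) / σ j := by
    rw [div_le_iff₀ zj]
    calc H = H * (M + 1) / σ j * (σ j / (M + 1)) := by field_simp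
      _ ≤ H * (M + 1) / σ j * sdStep (σ j) M := by
          gcongr; exact le_sdStep hsj hj
  have e3 : H * M / σ j ≤ H / sdStep (σ j) M := by
    rw [le_div_iff₀ zj]
    calc H * M / σ j * sdStep (σ j) M ≤ H * M / σ j * (σ j / M) := by
          gcongr; exact sdStep_le hsj hj
      _ = H := by field_simp
  have e4 : sdStep (σ i) N ≤ Real.exp (H / sdStep (σ j) M) * sdStep (σ j) M :=
    (sdStep_le hsi h).trans (hij.trans (mul_le_mul (Real.exp_le_exp.2 e3) (le_sdStep hsj hj)
      (by positivity) (Real.exp_nonneg _)))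
  have := le_add_one_of_mul_f_le zj e4 key
  linarith

lemma gap_mul_le_two_mul_of_pulled (hrule : IsKGRule σ rule) (hσ : ∀ i, 0 < σ i) {n : ℕ}
    {i : Fin k} (hi : pulled σ rule x n = i) (h : 0 < pulls σ rule x i n) (j : Fin k)
    (hij : 2 * σ i * pulls σ rule x j n ≤ σ j * pulls σ rule x i n) :
    gap (fun l => mean σ rule x l n) i * pulls σ rule x i n / σ i ≤
      2 * (pulls σ rule x j n * gap (fun l => mean σ rule x l n) j) / σ j + 1 := by
  have hj : 0 < pulls σ rule x j n := by
    subst hi; exact pulls_pos_of_pulled hrule hσ h j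
  have hN : (0 : ℝ) < pulls σ rule x i n := by exact_mod_cast h
  have hM : (1 : ℝ) ≤ pulls σ rule x j n := by exact_mod_cast hj
  have hsi := hσ i
  have hsj := hσ j
  have hH : 0 ≤ gap (fun l => mean σ rule x l n) j := gap_nonneg _ _
  refine (gap_mul_le_of_pulled hrule hσ hi h j ?_).trans ?_
  · calc σ i / pulls σ rule x i n ≤ σ j / (pulls σ rule x j n + 1) := by
          rw [div_le_div_iff₀ hN (by positivity)]
          nlinarith
      _ ≤ _ := by
          refine le_mul_of_one_le_left (by positivity) (Real.one_le_exp ?_)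
          positivity
  · gcongr ?_ / _ + _
    nlinarith

/-- The best of the other arms has been pulled about as often as the arm that is pulled now. -/
lemma mul_pulls_le_pulls_partner (hrule : IsKGRule σ rule) (hσ : ∀ i, 0 < σ i) {n : ℕ}
    {i l : Fin k} (hi : pulled σ rule x n = i) (h : 0 < pulls σ rule x i n) (hl : l ≠ i)
    (hmax : ∀ j, j ≠ i → mean σ rule x j n ≤ mean σ rule x l n) :
    σ l * pulls σ rule x i n ≤ 2 * (σ i * pulls σ rule x l n) := by
  have hl' : 0 < pulls σ rule x l n := by
    subst hi; exact pulls_pos_of_pulled hrule hσ h l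
  have key := le_of_mul_f_le (sdStep_pos (hσ i) h) (gap_nonneg _ _)
    (gap_partner_le (θ := fun j => mean σ rule x j n) hl hmax) (kg_le_of_pulled hrule hσ hi h l)
  have hN : (0 : ℝ) < pulls σ rule x i n := by exact_mod_cast h
  have hM : (1 : ℝ) ≤ pulls σ rule x l n := by exact_mod_cast hl'
  have h1 := ((le_sdStep (hσ l) hl').trans key).trans (sdStep_le (hσ i) h)
  rw [div_le_div_iff₀ (by positivity) hN] at h1
  nlinarith [hσ i]

/-- `s ^ (1 / 14)`. All powers of the time that occur in the growth argument are integer powers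
of it. -/
noncomputable def root (s : ℕ) : ℝ := (s : ℝ) ^ (1 / 14 : ℝ)

lemma root_nonneg (s : ℕ) : 0 ≤ root s := by unfold root; positivity

lemma root_pow (s : ℕ) : root s ^ 14 = s := by
  rw [root, ← Real.rpow_natCast, ← Real.rpow_mul (Nat.cast_nonneg s)]
  norm_num

lemma sqrt_eq_root_pow (s : ℕ) : √(s : ℝ) = root s ^ 7 := by
  rw [Real.sqrt_eq_iff_mul_self_eq (by positivity) (pow_nonneg (root_nonneg s) 7), ← root_pow]
  ring

lemma tendsto_root : Tendsto root atTop atTop :=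
  (tendsto_rpow_atTop (by norm_num)).comp tendsto_natCast_atTop_atTop

lemma eventually_mul_root_pow_le (A : ℝ) {B : ℝ} (hB : 0 < B) {m n : ℕ} (hmn : m < n) :
    ∀ᶠ s in atTop, A * root s ^ m ≤ B * root s ^ n := by
  filter_upwards [tendsto_root.eventually_ge_atTop (max 1 (A / B))] with s hs
  have h1 : 1 ≤ root s := (le_max_left _ _).trans hs
  have h2 : A / B ≤ root s := (le_max_right _ _).trans hs
  rw [div_le_iff₀ hB] at h2
  calc A * root s ^ m ≤ root s * B * root s ^ m := by gcongr
    _ = B * root s ^ (m + 1) := by ring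
    _ ≤ B * root s ^ n := by exact mul_le_mul_of_nonneg_left (pow_le_pow_right₀ h1 hmn) hB.le

/-- Up to time `s` the posterior mean of every arm with `n ≥ 1` pulls is within
`s ^ (1 / 7) / √n` of the true mean. -/
def Concentrated (μ σ : Fin k → ℝ) (rule : Knowledge k → Fin k) (x : Fin k → ℕ → ℝ)
    (s : ℕ) : Prop :=
  ∀ u ≤ s, ∀ j, 0 < pulls σ rule x j u →
    |mean σ rule x j u - μ j| ≤ root s ^ 2 / √(pulls σ rule x j u : ℝ)

open Classical in
/-- The rounds up to `s` in which arm `i` is pulled while the arms `i` and `j` have a number of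
pulls of order `s` and their posterior means are within `C * s ^ (-5 / 7)`. -/
noncomputable def tiedRounds (σ : Fin k → ℝ) (rule : Knowledge k → Fin k) (κ C : ℝ)
    (x : Fin k → ℕ → ℝ) (i j : Fin k) (s : ℕ) : Finset ℕ :=
  (Finset.range s).filter fun u => pulled σ rule x u = i ∧ κ * s ≤ pulls σ rule x i u ∧
    κ * s ≤ pulls σ rule x j u ∧ |mean σ rule x i u - mean σ rule x j u| ≤ C / root s ^ 10

lemma Concentrated.abs_sub_le {s : ℕ} (hA : Concentrated μ σ rule x s) {c : ℝ} (hc : 0 < c)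
    (hs : 0 < s) {u : ℕ} (hu : u ≤ s) {j : Fin k} (hj : c * s ≤ pulls σ rule x j u) :
    |mean σ rule x j u - μ j| ≤ (√c)⁻¹ / root s ^ 5 := by
  have hs' : (0 : ℝ) < s := by exact_mod_cast hs
  have hN : (0 : ℝ) < pulls σ rule x j u := lt_of_lt_of_le (by positivity) hj
  have hp : 0 < root s := by unfold root; positivity
  refine (hA u hu j (by exact_mod_cast hN)).trans ?_
  calc root s ^ 2 / √(pulls σ rule x j u : ℝ) ≤ root s ^ 2 / √(c * s) := by gcongr
    _ = (√c)⁻¹ / root s ^ 5 := by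
      rw [Real.sqrt_mul hc.le, sqrt_eq_root_pow]
      field_simp

set_option maxHeartbeats 400000 in
/-- The dichotomy behind linear growth. Suppose that an arm `i` with many pulls is pulled. Either
its gap is of constant order, and then no arm is undersampled, or the two top arms have equal true
means. In the second case the best arm is underestimated, hence has few pulls, and the rule forces
the gap of `i` to be tiny. -/
lemma pulls_ge_or_tied (hk : 2 ≤ k) (hrule : IsKGRule σ rule) {b : Fin k}
    (hb : ∀ i, i ≠ b → μ i < μ b) {lo hi g D κ ε C r : ℝ} (hlo : 0 < lo) (hσlo : ∀ i, lo ≤ σ i)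
    (hσhi : ∀ i, σ i ≤ hi) (hg : 0 < g) (hμg : ∀ i j, μ i ≠ μ j → g ≤ |μ i - μ j|)
    (hD : ∀ i j, μ i - μ j ≤ D) (hκ : κ * (4 * k * hi) = lo) (hε : 0 < ε) (hεκ : ε ≤ κ) {s : ℕ}
    (hs : 0 < s) (hr : (√κ)⁻¹ / root s ^ 5 ≤ r) (hr1 : r ≤ 1) (hrg : r ≤ g / 4)
    (h1 : 16 * k * hi * root s ^ 4 ≤ lo * g ^ 2 * root s ^ 14)
    (h2 : 2 * k * hi * (4 * root s ^ 4 / (g * lo) + 1) ≤ C * root s ^ 4)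
    (h3 : 2 * (ε * s * (D + 1) + root s ^ 2 * √(ε * s)) / lo + 1 < s * g / (4 * k * hi))
    (hA : Concentrated μ σ rule x s) {u : ℕ} (hu : u ≤ s) {i : Fin k}
    (hi' : pulled σ rule x u = i) (hN : s / (2 * k) ≤ (pulls σ rule x i u : ℝ)) :
    (∀ j, ε * s ≤ pulls σ rule x j u) ∨
      ∃ l, i ≠ l ∧ μ i = μ l ∧ κ * s ≤ pulls σ rule x i u ∧ κ * s ≤ pulls σ rule x l u ∧
        |mean σ rule x i u - mean σ rule x l u| ≤ C / root s ^ 10 := by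
  have hσ : ∀ i, 0 < σ i := fun i => hlo.trans_le (hσlo i)
  have hhi : 0 < hi := (hσ i).trans_le (hσhi i)
  have hlh : lo ≤ hi := (hσlo i).trans (hσhi i)
  have hk0 : (0 : ℝ) < k := by exact_mod_cast (by omega : 0 < k)
  have hs0 : (0 : ℝ) < s := by exact_mod_cast hs
  have hp : 0 < root s := by unfold root; positivity
  have hps := root_pow s
  set p := root s with hpdef
  have hκ0 : 0 < κ := hε.trans_le hεκ
  have hNpos : (0 : ℝ) < pulls σ rule x i u := lt_of_lt_of_le (by positivity) hN
  have hNpos' : 0 < pulls σ rule x i u := by exact_mod_cast hNpos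
  have hpos : ∀ j, 0 < pulls σ rule x j u := fun j => by
    subst hi'; exact pulls_pos_of_pulled hrule hσ hNpos' j
  have hN' : (s : ℝ) ≤ 2 * k * pulls σ rule x i u := by
    rw [div_le_iff₀ (by positivity)] at hN; linarith
  obtain ⟨l, hli, hsup⟩ := exists_iSup_ne_eq hk (fun j => mean σ rule x j u) i
  have hmax : ∀ j, j ≠ i → mean σ rule x j u ≤ mean σ rule x l u := fun j hj => by
    rw [← hsup]; exact le_iSup_ne (fun j => mean σ rule x j u) hj
  have hgi := gap_eq_of_forall_le (θ := fun j => mean σ rule x j u) hli hmax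
  have hpart := mul_pulls_le_pulls_partner hrule hσ hi' hNpos' hli hmax
  have hMpos : (0 : ℝ) < pulls σ rule x l u := by exact_mod_cast hpos l
  have hNl : κ * s ≤ pulls σ rule x l u := by
    have e1 : lo * pulls σ rule x i u ≤ 2 * (hi * pulls σ rule x l u) :=
      (mul_le_mul_of_nonneg_right (hσlo l) hNpos.le).trans
        (hpart.trans (by have := hσhi i; gcongr))
    refine le_of_mul_le_mul_left ?_ (show 0 < 4 * k * hi by positivity)
    calc 4 * k * hi * (κ * s) = lo * s := by rw [← hκ]; ring
      _ ≤ lo * (2 * k * pulls σ rule x i u) := by gcongr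
      _ = 2 * k * (lo * pulls σ rule x i u) := by ring
      _ ≤ 2 * k * (2 * (hi * pulls σ rule x l u)) := by gcongr
      _ = _ := by ring
  have hNi : κ * s ≤ pulls σ rule x i u := by
    refine le_of_mul_le_mul_left ?_ (show 0 < 4 * k * hi by positivity)
    calc 4 * k * hi * (κ * s) = lo * s := by rw [← hκ]; ring
      _ ≤ (2 * hi) * (2 * k * pulls σ rule x i u) := by gcongr; linarith
      _ = _ := by ring
  have hdi := (hA.abs_sub_le hκ0 hs hu hNi).trans hr
  have hdl := (hA.abs_sub_le hκ0 hs hu hNl).trans hr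
  rw [abs_le] at hdi hdl
  by_cases htie : μ i = μ l
  · right
    refine ⟨l, hli.symm, htie, hNi, hNl, ?_⟩
    have hbi : b ≠ i := by rintro rfl; exact absurd (hb l hli) (by rw [htie]; exact lt_irrefl _)
    have hbl : b ≠ l := by
      rintro rfl; exact absurd (hb i hli.symm) (by rw [htie]; exact lt_irrefl _)
    have hgb := gap_eq_max_sub (θ := fun j => mean σ rule x j u) hmax hbi hbl
    have hgb0 := gap_nonneg (fun j => mean σ rule x j u) b
    have hB := hA u hu b (hpos b)
    rw [abs_le] at hB
    have hmuB : g ≤ μ b - μ i := by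
      have e := hμg b i (hb i hbi.symm).ne'
      rwa [abs_of_pos (by linarith [hb i hbi.symm])] at e
    have hBpos : (0 : ℝ) < pulls σ rule x b u := by exact_mod_cast hpos b
    set y := √(pulls σ rule x b u : ℝ) with hy
    have hy0 : 0 < y := Real.sqrt_pos.2 hBpos
    have hyy : y ^ 2 = pulls σ rule x b u := Real.sq_sqrt hBpos.le
    have hmx : max (mean σ rule x i u) (mean σ rule x l u) ≤ μ i + r :=
      max_le (by linarith) (by linarith)
    have hgy : g / 2 ≤ p ^ 2 / y := by
      have : g - r ≤ p ^ 2 / y := by linarith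
      linarith
    have hgy2 : g * y ≤ 2 * p ^ 2 := by
      rw [le_div_iff₀ hy0] at hgy; linarith
    have hgap : gap (fun j => mean σ rule x j u) b ≤ p ^ 2 / y := by linarith
    have hcmp := gap_mul_le_two_mul_of_pulled hrule hσ hi' hNpos' b (by
      rw [← hyy]
      have e1 : g ^ 2 * y ^ 2 ≤ 4 * p ^ 4 := by
        calc g ^ 2 * y ^ 2 = (g * y) ^ 2 := by ring
          _ ≤ (2 * p ^ 2) ^ 2 := by gcongr
          _ = 4 * p ^ 4 := by ring
      have e2 : 4 * k * hi * (g ^ 2 * y ^ 2) ≤ lo * g ^ 2 * s := by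
        rw [← hps]
        refine le_trans ?_ h1
        calc 4 * k * hi * (g ^ 2 * y ^ 2) ≤ 4 * k * hi * (4 * p ^ 4) := by gcongr
          _ = _ := by ring
      have e3 : g ^ 2 * (4 * k * hi * y ^ 2) ≤ g ^ 2 * (lo * s) := by linarith
      have e4 := le_of_mul_le_mul_left e3 (by positivity)
      have e5 : 2 * k * (2 * hi * y ^ 2) ≤ 2 * k * (lo * pulls σ rule x i u) := by
        calc 2 * k * (2 * hi * y ^ 2) = 4 * k * hi * y ^ 2 := by ring
          _ ≤ lo * s := e4
          _ ≤ lo * (2 * k * pulls σ rule x i u) := by gcongr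
          _ = _ := by ring
      have e6 := le_of_mul_le_mul_left e5 (by positivity)
      calc 2 * σ i * y ^ 2 ≤ 2 * hi * y ^ 2 := by have := hσhi i; gcongr
        _ ≤ lo * pulls σ rule x i u := e6
        _ ≤ σ b * pulls σ rule x i u := by have := hσlo b; gcongr)
    rw [hgi, ← hyy] at hcmp
    have e1 : 2 * (y ^ 2 * gap (fun j => mean σ rule x j u) b) / σ b ≤ 4 * p ^ 4 / (g * lo) := by
      have e : y ^ 2 * gap (fun j => mean σ rule x j u) b ≤ y * p ^ 2 := by
        calc y ^ 2 * gap (fun j => mean σ rule x j u) b ≤ y ^ 2 * (p ^ 2 / y) := by gcongr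
          _ = y * p ^ 2 := by field_simp
      rw [div_le_div_iff₀ (hσ b) (by positivity)]
      calc 2 * (y ^ 2 * gap (fun j => mean σ rule x j u) b) * (g * lo)
          ≤ 2 * (y * p ^ 2) * (g * lo) := by gcongr
        _ = 2 * lo * p ^ 2 * (g * y) := by ring
        _ ≤ 2 * lo * p ^ 2 * (2 * p ^ 2) := by gcongr
        _ = 4 * p ^ 4 * lo := by ring
        _ ≤ 4 * p ^ 4 * σ b := by have := hσlo b; gcongr
    have e2 : |mean σ rule x i u - mean σ rule x l u| * s ≤ C * p ^ 4 := by
      refine le_trans ?_ h2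
      have e3 := hcmp.trans (add_le_add_left e1 1)
      rw [div_le_iff₀ (hσ i)] at e3
      calc |mean σ rule x i u - mean σ rule x l u| * s
          ≤ |mean σ rule x i u - mean σ rule x l u| * (2 * k * pulls σ rule x i u) := by gcongr
        _ = 2 * k * (|mean σ rule x i u - mean σ rule x l u| * pulls σ rule x i u) := by ring
        _ ≤ 2 * k * ((4 * p ^ 4 / (g * lo) + 1) * σ i) := by gcongr
        _ ≤ 2 * k * ((4 * p ^ 4 / (g * lo) + 1) * hi) := by have := hσhi i; gcongr
        _ = _ := by ring
    rw [le_div_iff₀ (by positivity)]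
    rw [← hps] at e2
    have e4 : p ^ 4 * (|mean σ rule x i u - mean σ rule x l u| * p ^ 10) ≤ p ^ 4 * C := by
      linarith
    exact le_of_mul_le_mul_left e4 (by positivity)
  · left
    by_contra! hcon
    obtain ⟨j, hj⟩ := hcon
    have hεκs : ε * s ≤ κ * s := by gcongr
    have hji : j ≠ i := by rintro rfl; linarith
    have hjl : j ≠ l := by rintro rfl; linarith
    have hgj := gap_eq_max_sub (θ := fun j => mean σ rule x j u) hmax hji hjl
    have hJ := hA u hu j (hpos j)
    rw [abs_le] at hJ
    have hJpos : (0 : ℝ) < pulls σ rule x j u := by exact_mod_cast hpos j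
    set y := √(pulls σ rule x j u : ℝ) with hy
    have hy0 : 0 < y := Real.sqrt_pos.2 hJpos
    have hyy : y ^ 2 = pulls σ rule x j u := Real.sq_sqrt hJpos.le
    have hgap : gap (fun j => mean σ rule x j u) j ≤ D + 1 + p ^ 2 / y := by
      have e : max (mean σ rule x i u) (mean σ rule x l u) ≤ D + μ j + r :=
        max_le (by linarith [hD i j]) (by linarith [hD l j])
      linarith
    have hgi2 : g / 2 ≤ |mean σ rule x i u - mean σ rule x l u| := by
      have e := hμg i l htie
      have e2 : |μ i - μ l| ≤ |mean σ rule x i u - mean σ rule x l u| + 2 * r := by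
        rw [abs_le]
        have e3 := abs_le.1 (le_refl |mean σ rule x i u - mean σ rule x l u|)
        constructor <;> linarith
      linarith
    have hcmp := gap_mul_le_two_mul_of_pulled hrule hσ hi' hNpos' j (by
      have e1 : 4 * k * hi * (pulls σ rule x j u : ℝ) ≤ lo * s := by
        rw [← hκ]
        calc 4 * k * hi * (pulls σ rule x j u : ℝ) ≤ 4 * k * hi * (κ * s) := by gcongr; linarith
          _ = _ := by ring
      have e5 : 2 * k * (2 * hi * pulls σ rule x j u) ≤ 2 * k * (lo * pulls σ rule x i u) := by
        calc 2 * k * (2 * hi * pulls σ rule x j u) = 4 * k * hi * pulls σ rule x j u := by ring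
          _ ≤ lo * s := e1
          _ ≤ lo * (2 * k * pulls σ rule x i u) := by gcongr
          _ = _ := by ring
      have e6 := le_of_mul_le_mul_left e5 (by positivity)
      calc 2 * σ i * pulls σ rule x j u ≤ 2 * hi * pulls σ rule x j u := by
            have := hσhi i; gcongr
        _ ≤ lo * pulls σ rule x i u := e6
        _ ≤ σ j * pulls σ rule x i u := by have := hσlo j; gcongr)
    rw [hgi] at hcmp
    have hD0 : 0 ≤ D := by simpa using hD i i
    have e1 : 2 * (pulls σ rule x j u * gap (fun j => mean σ rule x j u) j) / σ j ≤
        2 * (ε * s * (D + 1) + p ^ 2 * √(ε * s)) / lo := by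
      have e2 : y ≤ √(ε * s) := Real.sqrt_le_sqrt hj.le
      have e : pulls σ rule x j u * gap (fun j => mean σ rule x j u) j ≤
          ε * s * (D + 1) + p ^ 2 * √(ε * s) := by
        calc pulls σ rule x j u * gap (fun j => mean σ rule x j u) j
            ≤ pulls σ rule x j u * (D + 1 + p ^ 2 / y) := by gcongr
          _ = pulls σ rule x j u * (D + 1) + p ^ 2 * y := by
              rw [← hyy]; field_simp
          _ ≤ _ := by gcongr
      have := hσlo j
      gcongr
    have e2 : s * g / (4 * k * hi) ≤
        |mean σ rule x i u - mean σ rule x l u| * pulls σ rule x i u / σ i := by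
      calc s * g / (4 * k * hi) = g / 2 * (s / (2 * k)) / hi := by field_simp; ring
        _ ≤ |mean σ rule x i u - mean σ rule x l u| * pulls σ rule x i u / σ i := by
          have := hσhi i
          have := hσ i
          gcongr
    linarith

/-- An arm is pulled at most `m` times while it has fewer than `m` pulls. -/
lemma card_pulled_filter_le (i : Fin k) (m s : ℕ) :
    ((Finset.range s).filter fun u => pulled σ rule x u = i ∧ pulls σ rule x i u < m).card ≤
      min m (pulls σ rule x i s) := by
  induction s with
  | zero => simp
  | succ s ih =>
    rw [Finset.range_add_one, Finset.filter_insert, pulls_succ]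
    split_ifs with h1 h2 h2
    · rw [Finset.card_insert_of_notMem (by simp)]; omega
    · exact absurd h1.1 h2
    · have : ¬ pulls σ rule x i s < m := fun h => h1 ⟨h2, h⟩
      omega
    · omega

lemma le_card_pulled_filter (i : Fin k) (a : ℝ) (ha : 0 ≤ a) (s : ℕ) :
    (pulls σ rule x i s : ℝ) - a - 1 ≤
      ((Finset.range s).filter
        fun u => pulled σ rule x u = i ∧ a ≤ (pulls σ rule x i u : ℝ)).card := by
  have h := card_pulled_filter_le (σ := σ) (rule := rule) (x := x) i ⌈a⌉₊ s
  have h2 : pulls σ rule x i s ≤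
      ((Finset.range s).filter
        fun u => pulled σ rule x u = i ∧ pulls σ rule x i u < ⌈a⌉₊).card +
      ((Finset.range s).filter
        fun u => pulled σ rule x u = i ∧ a ≤ (pulls σ rule x i u : ℝ)).card := by
    refine le_trans (Finset.card_le_card ?_) (Finset.card_union_le _ _)
    intro u hu
    simp only [Finset.mem_union, Finset.mem_filter] at hu ⊢
    rcases lt_or_ge (pulls σ rule x i u : ℝ) a with h | h
    · left; exact ⟨hu.1, hu.2, Nat.lt_ceil.2 h⟩
    · right; exact ⟨hu.1, hu.2, h⟩
  have h3 : (pulls σ rule x i s : ℝ) ≤ ⌈a⌉₊ + ((Finset.range s).filter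
        fun u => pulled σ rule x u = i ∧ a ≤ (pulls σ rule x i u : ℝ)).card := by
    exact_mod_cast h2.trans (by gcongr; omega)
  have := Nat.ceil_lt_add_one ha
  linarith

/-- Linear growth of all numbers of pulls, on trajectories that are concentrated and on which no
two arms with equal means remain close for a positive fraction of time. -/
lemma exists_linear_growth (hk : 2 ≤ k) (hσ : ∀ i, 0 < σ i) {b : Fin k}
    (hb : ∀ i, i ≠ b → μ i < μ b) :
    ∃ κ > 0, ∃ C > 0, ∃ ε > 0, ∀ᶠ s : ℕ in atTop, ∀ (rule : Knowledge k → Fin k)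
      (x : Fin k → ℕ → ℝ), IsKGRule σ rule → Concentrated μ σ rule x s →
      (∀ i j, i ≠ j → μ i = μ j → ((tiedRounds σ rule κ C x i j s).card : ℝ) < s / (4 * k ^ 2)) →
      ∀ j, ε * s ≤ (pulls σ rule x j s : ℝ) := by
  have : Nonempty (Fin k) := ⟨b⟩
  obtain ⟨i₀, hi₀⟩ := Finite.exists_min σ
  obtain ⟨i₁, hi₁⟩ := Finite.exists_max σ
  obtain ⟨p₀, hp₀⟩ := Finite.exists_min fun p : Fin k × Fin k =>
    if μ p.1 = μ p.2 then (1 : ℝ) else |μ p.1 - μ p.2|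
  obtain ⟨p₁, hp₁⟩ := Finite.exists_max fun p : Fin k × Fin k => μ p.1 - μ p.2
  set lo := σ i₀
  set hi := σ i₁
  set D := μ p₁.1 - μ p₁.2
  set g := if μ p₀.1 = μ p₀.2 then (1 : ℝ) else |μ p₀.1 - μ p₀.2| with hgdef
  have hg : 0 < g := by
    rw [hgdef]; split_ifs with h
    · exact one_pos
    · exact abs_pos.2 (sub_ne_zero.2 h)
  have hμg : ∀ i j, μ i ≠ μ j → g ≤ |μ i - μ j| := fun i j hij => by
    have := hp₀ (i, j); simpa [hij] using this
  have hD : ∀ i j, μ i - μ j ≤ D := fun i j => hp₁ (i, j)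
  have hD0 : 0 ≤ D := by simpa using hD b b
  have hlo : 0 < lo := hσ _
  have hhi : 0 < hi := hσ _
  have hk0 : (0 : ℝ) < k := by exact_mod_cast (by omega : 0 < k)
  have hk1 : (2 : ℝ) ≤ k := by exact_mod_cast hk
  set κ := lo / (4 * k * hi) with hκ
  have hκ0 : 0 < κ := by positivity
  have hκ1 : κ ≤ 1 := by
    rw [hκ, div_le_one (by positivity)]
    have : lo ≤ hi := hi₀ i₁
    nlinarith
  -- `ε ≤ κ` keeps an undersampled arm apart from the pulled arm and its partner
  set ε := min κ (g * lo / (32 * k * hi * (D + 1))) with hε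
  have hε0 : 0 < ε := lt_min hκ0 (by positivity)
  set C := 2 * k * hi * (4 / (g * lo) + 1) with hC
  refine ⟨κ, hκ0, C, by positivity, ε, hε0, ?_⟩
  filter_upwards [eventually_mul_root_pow_le ((√κ)⁻¹) (B := min 1 (g / 4))
      (lt_min one_pos (by positivity)) (show 0 < 5 by norm_num),
    eventually_mul_root_pow_le (16 * k * hi) (B := lo * g ^ 2) (by positivity)
      (show 4 < 14 by norm_num),
    eventually_mul_root_pow_le (2 / lo + 1) (B := g / (16 * k * hi)) (by positivity)
      (show 9 < 14 by norm_num),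
    eventually_gt_atTop (4 * k), tendsto_root.eventually_ge_atTop 1]
    with s hr h1 h3 hsk hp1 rule x hrule hA hB
  have hs : 0 < s := by omega
  have hs0 : (0 : ℝ) < s := by exact_mod_cast hs
  have hp : 0 < root s := by linarith
  have hps := root_pow s
  have key : ∀ (i : Fin k) (u : ℕ), u ≤ s → pulled σ rule x u = i →
      s / (2 * k) ≤ (pulls σ rule x i u : ℝ) → _ := fun i u hu hi' hN =>
    pulls_ge_or_tied (C := C) hk hrule hb hlo hi₀ hi₁ hg hμg hD (κ := κ)
      (by rw [hκ]; field_simp) hε0 (min_le_left _ _) hs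
      (r := min 1 (g / 4)) (by rw [div_le_iff₀ (by positivity)]; simpa using hr)
      (min_le_left _ _) (min_le_right _ _) h1
      (by
        have e : 1 ≤ root s ^ 4 := one_le_pow₀ hp1
        rw [hC, mul_assoc (2 * k * hi)]
        gcongr
        rw [add_mul, one_mul, div_mul_eq_mul_div]
        gcongr)
      (by
        have e1 : ε * s * (D + 1) ≤ g * lo / (32 * k * hi) * s := by
          calc ε * s * (D + 1) ≤ g * lo / (32 * k * hi * (D + 1)) * s * (D + 1) := by
                gcongr; exact min_le_right _ _
            _ = _ := by field_simp
        have e2 : √(ε * s) ≤ root s ^ 7 := by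
          rw [← sqrt_eq_root_pow]
          apply Real.sqrt_le_sqrt
          have : ε ≤ 1 := (min_le_left _ _).trans hκ1
          nlinarith
        have e3 : 1 ≤ root s ^ 9 := one_le_pow₀ hp1
        calc 2 * (ε * s * (D + 1) + root s ^ 2 * √(ε * s)) / lo + 1
            ≤ 2 * (g * lo / (32 * k * hi) * s + root s ^ 2 * root s ^ 7) / lo + 1 := by
              gcongr
          _ = g / (16 * k * hi) * s + 2 / lo * root s ^ 9 + 1 := by field_simp; ring
          _ ≤ g / (16 * k * hi) * s + (2 / lo + 1) * root s ^ 9 := by linarith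
          _ ≤ g / (16 * k * hi) * s + g / (16 * k * hi) * s := by rw [hps] at h3; linarith
          _ < s * g / (4 * k * hi) := by
              rw [← sub_pos]
              have : s * g / (4 * k * hi) - (g / (16 * k * hi) * s + g / (16 * k * hi) * s) =
                s * g / (8 * k * hi) := by field_simp; ring
              rw [this]; positivity)
      hA hu hi' hN
  by_contra! hcon
  obtain ⟨j, hj⟩ := hcon
  -- some arm has received at least the average number of pulls
  obtain ⟨i, hi⟩ : ∃ i, (s : ℝ) / k ≤ pulls σ rule x i s := by
    by_contra! hall
    have e1 : ∑ i, (pulls σ rule x i s : ℝ) < ∑ _i : Fin k, (s : ℝ) / k :=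
      Finset.sum_lt_sum_of_nonempty Finset.univ_nonempty fun i _ => hall i
    have e2 : ∑ i, (pulls σ rule x i s : ℝ) = s := by exact_mod_cast sum_pulls s
    rw [e2, Finset.sum_const, Finset.card_univ, Fintype.card_fin, nsmul_eq_mul,
      mul_div_cancel₀ _ hk0.ne'] at e1
    exact lt_irrefl _ e1
  have hcard := le_card_pulled_filter (σ := σ) (rule := rule) (x := x) i (s / (2 * k))
    (by positivity) s
  -- all its pulls beyond the first `s / (2 * k)` ones are tied with one of at most `k` partners
  classical
  have hsub : ((Finset.range s).filter
        fun u => pulled σ rule x u = i ∧ s / (2 * k) ≤ (pulls σ rule x i u : ℝ)) ⊆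
      (Finset.univ.filter fun l => i ≠ l ∧ μ i = μ l).biUnion
        fun l => tiedRounds σ rule κ C x i l s := by
    intro u hu
    simp only [Finset.mem_filter, Finset.mem_range, Finset.mem_biUnion, Finset.mem_univ,
      true_and, tiedRounds] at hu ⊢
    rcases key i u hu.1.le hu.2.1 hu.2.2 with h | ⟨l, h1, h2, h3, h4, h5⟩
    · have e : (pulls σ rule x j u : ℝ) ≤ pulls σ rule x j s := by
        exact_mod_cast pulls_mono j hu.1.le
      exact absurd (h j) (by linarith)
    · exact ⟨l, ⟨h1, h2⟩, hu.1, hu.2.1, h3, h4, h5⟩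
  have hle : (((Finset.range s).filter
        fun u => pulled σ rule x u = i ∧ s / (2 * k) ≤ (pulls σ rule x i u : ℝ)).card : ℝ) ≤
      k * (s / (4 * k ^ 2)) := by
    calc (((Finset.range s).filter
        fun u => pulled σ rule x u = i ∧ s / (2 * k) ≤ (pulls σ rule x i u : ℝ)).card : ℝ)
        ≤ ∑ l ∈ Finset.univ.filter fun l => i ≠ l ∧ μ i = μ l,
            ((tiedRounds σ rule κ C x i l s).card : ℝ) := by
          exact_mod_cast (Finset.card_le_card hsub).trans Finset.card_biUnion_le
      _ ≤ ∑ l ∈ Finset.univ.filter fun l => i ≠ l ∧ μ i = μ l, (s : ℝ) / (4 * k ^ 2) := by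
          refine Finset.sum_le_sum fun l hl => ?_
          simp only [Finset.mem_filter, Finset.mem_univ, true_and] at hl
          exact (hB i l hl.1 hl.2).le
      _ ≤ k * (s / (4 * k ^ 2)) := by
          rw [Finset.sum_const, nsmul_eq_mul]
          gcongr
          calc _ ≤ (Finset.univ : Finset (Fin k)).card := Finset.card_filter_le _ _
            _ = k := by simp
  have hsk' : (4 : ℝ) * k < s := by exact_mod_cast hsk
  have e1 : (s : ℝ) / k - s / (2 * k) - 1 ≤ k * (s / (4 * k ^ 2)) := by linarith
  have e2 : (s : ℝ) / k - s / (2 * k) - k * (s / (4 * k ^ 2)) = s / (4 * k) := by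
    field_simp; ring
  have e3 : 1 < (s : ℝ) / (4 * k) := by rw [lt_div_iff₀ (by positivity)]; linarith
  linarith

end Growth

/-! ### Measurability and predictability -/

section Measurability

variable {k : ℕ} {σ : Fin k → ℝ} {rule : Knowledge k → Fin k}

/-- The array of rewards with everything after the first `n` rounds replaced by `0`. A function `Φ`
of the array with `Φ (trunc n x) = Φ x` is one that depends on the first `n` rounds only. -/
def trunc (n : ℕ) (x : Fin k → ℕ → ℝ) : Fin k → ℕ → ℝ := fun i m => if m < n then x i m else 0

lemma trunc_trunc {u n : ℕ} (h : u ≤ n) (x : Fin k → ℕ → ℝ) :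
    trunc u (trunc n x) = trunc u x := by
  funext i m
  simp only [trunc]
  split_ifs with h1 h2
  · rfl
  · omega
  · rfl

lemma knowledge_trunc (x : Fin k → ℕ → ℝ) {u n : ℕ} (h : u ≤ n) :
    knowledge σ rule (trunc n x) u = knowledge σ rule x u := by
  induction u with
  | zero => rfl
  | succ u ih =>
    simp only [knowledge, ih (by omega)]
    rw [trunc, if_pos (by omega)]

lemma pulled_trunc (x : Fin k → ℕ → ℝ) {u n : ℕ} (h : u ≤ n) :
    pulled σ rule (trunc n x) u = pulled σ rule x u := by
  rw [pulled, knowledge_trunc x h, pulled]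

lemma pulls_trunc (x : Fin k → ℕ → ℝ) (i : Fin k) {u n : ℕ} (h : u ≤ n) :
    pulls σ rule (trunc n x) i u = pulls σ rule x i u := by
  unfold pulls
  congr 1
  refine Finset.filter_congr fun m hm => ?_
  rw [pulled_trunc x (by have := Finset.mem_range.1 hm; omega)]

lemma mean_trunc (x : Fin k → ℕ → ℝ) (i : Fin k) {u n : ℕ} (h : u ≤ n) :
    mean σ rule (trunc n x) i u = mean σ rule x i u := by
  rw [mean, knowledge_trunc x h, mean]

lemma measurable_trunc (n : ℕ) : Measurable (trunc n : (Fin k → ℕ → ℝ) → Fin k → ℕ → ℝ) := by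
  refine measurable_pi_iff.2 fun i => measurable_pi_iff.2 fun m => ?_
  unfold trunc
  split_ifs
  · fun_prop
  · exact measurable_const

lemma measurable_knowledge (hrule : Measurable rule) (n : ℕ) :
    Measurable fun x : Fin k → ℕ → ℝ => knowledge σ rule x n := by
  induction n with
  | zero => exact measurable_const
  | succ n ih =>
    have h : Measurable fun p : Fin k × (Knowledge k × (Fin k → ℕ → ℝ)) =>
        update σ p.2.1 p.1 (p.2.2 p.1 n) := by
      refine measurable_from_prod_countable_right fun a => ?_
      unfold update
      refine Measurable.prodMk (measurable_pi_iff.2 fun j => ?_) (measurable_pi_iff.2 fun j => ?_)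
      · by_cases hj : j = a
        · subst hj
          simp only [Function.update_self, nextMean]
          fun_prop
        · simp only [Function.update_of_ne hj]
          fun_prop
      · by_cases hj : j = a
        · subst hj
          simp only [Function.update_self, nextVar]
          fun_prop
        · simp only [Function.update_of_ne hj]
          fun_prop
    exact h.comp ((hrule.comp ih).prodMk (ih.prodMk measurable_id))

lemma measurable_pulled (hrule : Measurable rule) (n : ℕ) :
    Measurable fun x : Fin k → ℕ → ℝ => pulled σ rule x n :=
  hrule.comp (measurable_knowledge hrule n)

lemma measurable_mean (hrule : Measurable rule) (i : Fin k) (n : ℕ) :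
    Measurable fun x : Fin k → ℕ → ℝ => mean σ rule x i n :=
  (measurable_pi_apply i).comp (measurable_fst.comp (measurable_knowledge hrule n))

lemma measurable_pulls (hrule : Measurable rule) (i : Fin k) (n : ℕ) :
    Measurable fun x : Fin k → ℕ → ℝ => pulls σ rule x i n := by
  induction n with
  | zero => simp
  | succ n ih =>
    simp only [pulls_succ]
    refine ih.add (Measurable.ite ?_ measurable_const measurable_const)
    exact measurable_pulled hrule n (measurableSet_singleton i)

lemma measurable_pulled_reward (hrule : Measurable rule) (n : ℕ) :
    Measurable fun x : Fin k → ℕ → ℝ => x (pulled σ rule x n) n := by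
  have h : Measurable fun p : Fin k × (Fin k → ℕ → ℝ) => p.2 p.1 n :=
    measurable_from_prod_countable_right fun a => by fun_prop
  exact h.comp ((measurable_pulled hrule n).prodMk measurable_id)

end Measurability

/-! ### Exponential bounds for adaptively chosen rewards -/

section Chernoff

variable {Ω : Type*} [MeasurableSpace Ω] {P : Measure Ω} {k : ℕ}
  {μ σ : Fin k → ℝ} {rule : Knowledge k → Fin k} {X : Fin k → ℕ → Ω → ℝ}

lemma indepFun_trunc (hX : ∀ i n, Measurable (X i n))
    (hindep : iIndepFun (fun p : Fin k × ℕ => X p.1 p.2) P) (a : Fin k) (n : ℕ) :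
    IndepFun (fun ω => trunc n fun i m => X i m ω) (X a n) P := by
  have hdisj : Disjoint ((Finset.univ : Finset (Fin k)) ×ˢ Finset.range n) {(a, n)} := by
    simp
  have h := hindep.indepFun_finset _ _ hdisj fun p => hX p.1 p.2
  have hφ : Measurable fun (y : ((Finset.univ : Finset (Fin k)) ×ˢ Finset.range n) → ℝ)
      (i : Fin k) (m : ℕ) => if hm : m < n then y ⟨(i, m), by simp [hm]⟩ else (0 : ℝ) := by
    refine measurable_pi_iff.2 fun i => measurable_pi_iff.2 fun m => ?_
    by_cases hm : m < n
    · simp only [hm, dif_pos]; fun_prop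
    · simp only [hm, dif_neg, not_false_eq_true]; exact measurable_const
  have hψ : Measurable fun y : (({(a, n)} : Finset (Fin k × ℕ)) → ℝ) =>
      y ⟨(a, n), by simp⟩ := by fun_prop
  have h2 := h.comp hφ hψ
  refine h2.congr (ae_of_all _ fun ω => ?_) (ae_of_all _ fun ω => rfl)
  funext i m
  simp [trunc]

/-- One step of a nonnegative supermartingale whose multiplicative increment depends on the past
and on the reward of an arm selected by the past. -/
lemma lintegral_mul_le [IsProbabilityMeasure P] (hX : ∀ i n, Measurable (X i n))
    (hlaw : ∀ i n, P.map (X i n) = gaussianReal (μ i) (σ i ^ 2).toNNReal)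
    (hindep : iIndepFun (fun p : Fin k × ℕ => X p.1 p.2) P) (n : ℕ)
    {a : (Fin k → ℕ → ℝ) → Fin k} {Z : (Fin k → ℕ → ℝ) → ℝ≥0∞}
    {F : (Fin k → ℕ → ℝ) → ℝ → ℝ≥0∞} (ha : Measurable a) (hZ : Measurable Z)
    (hF : Measurable (Function.uncurry F)) (ha' : ∀ x, a (trunc n x) = a x)
    (hZ' : ∀ x, Z (trunc n x) = Z x) (hF' : ∀ x y, F (trunc n x) y = F x y)
    (hint : ∀ x, ∫⁻ y, F x y ∂gaussianReal (μ (a x)) (σ (a x) ^ 2).toNNReal ≤ 1) :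
    ∫⁻ ω, Z (fun i m => X i m ω) *
        F (fun i m => X i m ω) (X (a fun i m => X i m ω) n ω) ∂P ≤
      ∫⁻ ω, Z (fun i m => X i m ω) ∂P := by
  set A : Ω → Fin k → ℕ → ℝ := fun ω i m => X i m ω with hA
  have hAm : Measurable A := measurable_pi_iff.2 fun i => measurable_pi_iff.2 fun m => hX i m
  have hTm : Measurable fun ω => trunc n (A ω) := (measurable_trunc n).comp hAm
  set G : Fin k → (Fin k → ℕ → ℝ) → ℝ → ℝ≥0∞ := fun i x y => if a x = i then Z x * F x y else 0
  set H : Fin k → (Fin k → ℕ → ℝ) → ℝ≥0∞ := fun i x => if a x = i then Z x else 0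
  have hset : ∀ i, MeasurableSet {x | a x = i} := fun i => ha (measurableSet_singleton i)
  have hGm : ∀ i, Measurable (Function.uncurry (G i)) := fun i =>
    Measurable.ite (measurable_fst (hset i)) ((hZ.comp measurable_fst).mul hF) measurable_const
  have hHm : ∀ i, Measurable (H i) := fun i => Measurable.ite (hset i) hZ measurable_const
  have h1 : ∀ ω, Z (A ω) * F (A ω) (X (a (A ω)) n ω) = ∑ i, G i (trunc n (A ω)) (X i n ω) := by
    intro ω
    simp [G, ha', hZ', hF']
  have h2 : ∀ ω, Z (A ω) = ∑ i, H i (trunc n (A ω)) := by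
    intro ω
    simp [H, ha', hZ']
  have h3 : ∀ i, ∫⁻ ω, G i (trunc n (A ω)) (X i n ω) ∂P ≤ ∫⁻ ω, H i (trunc n (A ω)) ∂P := by
    intro i
    have hind := (indepFun_iff_map_prod_eq_prod_map_map hTm.aemeasurable
      (hX i n).aemeasurable).1 (indepFun_trunc hX hindep i n)
    calc ∫⁻ ω, G i (trunc n (A ω)) (X i n ω) ∂P
        = ∫⁻ p, Function.uncurry (G i) p ∂(P.map fun ω => (trunc n (A ω), X i n ω)) := by
          rw [lintegral_map (hGm i) (hTm.prodMk (hX i n))]; rfl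
      _ = ∫⁻ x, ∫⁻ y, G i x y ∂(P.map (X i n)) ∂(P.map fun ω => trunc n (A ω)) := by
          have := Measure.isProbabilityMeasure_map (μ := P) (hX i n).aemeasurable
          rw [hind, lintegral_prod _ (hGm i).aemeasurable]; rfl
      _ ≤ ∫⁻ x, H i x ∂(P.map fun ω => trunc n (A ω)) := by
          refine lintegral_mono fun x => ?_
          rw [hlaw]
          simp only [G, H]
          by_cases hx : a x = i
          · simp only [hx, if_true]
            have hFx : Measurable (F x) := hF.comp (measurable_const.prodMk measurable_id)
            rw [lintegral_const_mul _ hFx]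
            have := hint x
            rw [hx] at this
            exact mul_le_of_le_one_right' this
          · simp [hx]
      _ = ∫⁻ ω, H i (trunc n (A ω)) ∂P := lintegral_map (hHm i) hTm
  calc ∫⁻ ω, Z (A ω) * F (A ω) (X (a (A ω)) n ω) ∂P
      = ∑ i, ∫⁻ ω, G i (trunc n (A ω)) (X i n ω) ∂P := by
        simp_rw [h1]
        exact lintegral_finsetSum _ fun i _ => (hGm i).comp (hTm.prodMk (hX i n))
    _ ≤ ∑ i, ∫⁻ ω, H i (trunc n (A ω)) ∂P := Finset.sum_le_sum fun i _ => h3 i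
    _ = ∫⁻ ω, Z (A ω) ∂P := by
        simp_rw [h2]
        exact (lintegral_finsetSum _ fun i _ => (hHm i).comp hTm).symm

/-- Chernoff's bound for a sum of functions `φ u` of the reward of round `u + 1`, where `φ u` may
depend on the past. -/
lemma measure_le_sum_le [IsProbabilityMeasure P] (hX : ∀ i n, Measurable (X i n))
    (hlaw : ∀ i n, P.map (X i n) = gaussianReal (μ i) (σ i ^ 2).toNNReal)
    (hindep : iIndepFun (fun p : Fin k × ℕ => X p.1 p.2) P) (hrule : Measurable rule)
    {φ : ℕ → (Fin k → ℕ → ℝ) → ℝ → ℝ} (hφ : ∀ u, Measurable (Function.uncurry (φ u)))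
    (hφ' : ∀ u x y, φ u (trunc u x) y = φ u x y)
    (hint : ∀ u x, ∫⁻ y, ENNReal.ofReal (Real.exp (φ u x y))
      ∂gaussianReal (μ (pulled σ rule x u)) (σ (pulled σ rule x u) ^ 2).toNNReal ≤ 1)
    (s : ℕ) (c : ℝ) :
    P {ω | c ≤ ∑ u ∈ Finset.range s, φ u (fun i m => X i m ω)
        (X (pulled σ rule (fun i m => X i m ω) u) u ω)} ≤ ENNReal.ofReal (Real.exp (-c)) := by
  have hAm : Measurable fun ω => (fun i m => X i m ω : Fin k → ℕ → ℝ) :=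
    measurable_pi_iff.2 fun i => measurable_pi_iff.2 fun m => hX i m
  set S : ℕ → (Fin k → ℕ → ℝ) → ℝ := fun n x =>
    ∑ u ∈ Finset.range n, φ u x (x (pulled σ rule x u) u) with hS
  have hSm : ∀ n, Measurable (S n) := fun n => Finset.measurable_fun_sum _ fun u _ =>
    (hφ u).comp (measurable_id.prodMk (measurable_pulled_reward hrule u))
  have hSt : ∀ n x, S n (trunc n x) = S n x := by
    intro n x
    refine Finset.sum_congr rfl fun u hu => ?_
    have hu := Finset.mem_range.1 hu
    rw [← hφ' u (trunc n x), trunc_trunc hu.le, hφ', pulled_trunc x hu.le, trunc, if_pos hu]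
  have hE : ∀ n, ∫⁻ ω, ENNReal.ofReal (Real.exp (S n fun i m => X i m ω)) ∂P ≤ 1 := by
    intro n
    induction n with
    | zero => simp [hS]
    | succ n ih =>
      refine le_trans (le_of_eq ?_) ((lintegral_mul_le hX hlaw hindep n
        (a := fun x => pulled σ rule x n) (Z := fun x => ENNReal.ofReal (Real.exp (S n x)))
        (F := fun x y => ENNReal.ofReal (Real.exp (φ n x y))) (measurable_pulled hrule n)
        (hSm n).exp.ennreal_ofReal (hφ n).exp.ennreal_ofReal (fun x => pulled_trunc x le_rfl)
        (fun x => by rw [hSt]) (fun x y => by rw [hφ']) (hint n)).trans ih)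
      refine lintegral_congr fun ω => ?_
      rw [← ENNReal.ofReal_mul (Real.exp_nonneg _), ← Real.exp_add]
      simp only [hS, Finset.sum_range_succ]
  have hM := meas_ge_le_lintegral_div (μ := P) (ε := ENNReal.ofReal (Real.exp c))
    (((hSm s).comp hAm).exp.ennreal_ofReal.aemeasurable) (by simp [Real.exp_pos])
    ENNReal.ofReal_ne_top
  calc _ ≤ P {ω | ENNReal.ofReal (Real.exp c) ≤
        ENNReal.ofReal (Real.exp (S s fun i m => X i m ω))} := by
        refine measure_mono fun ω hω => ?_
        exact ENNReal.ofReal_le_ofReal (Real.exp_le_exp.2 hω)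
    _ ≤ _ := hM
    _ ≤ 1 / ENNReal.ofReal (Real.exp c) := by gcongr; exact hE s
    _ = ENNReal.ofReal (Real.exp (-c)) := by
        rw [one_div, ← ENNReal.ofReal_inv_of_pos (Real.exp_pos c), Real.exp_neg]

end Chernoff

/-! ### Gaussian integrals -/

lemma lintegral_gaussianReal_eq_std (m s : ℝ) {F : ℝ → ℝ≥0∞} (hF : Measurable F) :
    ∫⁻ y, F y ∂gaussianReal m (s ^ 2).toNNReal = ∫⁻ g, F (m + s * g) ∂gaussianReal 0 1 := by
  have h1 : (gaussianReal 0 1).map (fun g => m + s * g) = gaussianReal m (s ^ 2).toNNReal := by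
    have h2 := gaussianReal_map_const_mul (μ := 0) (v := 1) s
    have h3 := gaussianReal_map_const_add (μ := s * 0) (v := NNReal.mk (s ^ 2) (sq_nonneg s) * 1) m
    rw [← h2, Measure.map_map (by fun_prop) (by fun_prop)] at h3
    rw [show (fun g => m + s * g) = (fun x => m + x) ∘ (fun x => s * x) from rfl, h3]
    congr 1
    · ring
    · ext
      simp [Real.coe_toNNReal _ (sq_nonneg s)]
  rw [← h1, lintegral_map hF (by fun_prop)]

lemma integral_exp_mul_std (t : ℝ) :
    ∫ g, Real.exp (t * g) ∂gaussianReal 0 1 = Real.exp (t ^ 2 / 2) := by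
  have := mgf_gaussianReal (p := gaussianReal 0 1) (X := id) (μ := 0) (v := 1) (by simp) t
  simpa [mgf] using this

lemma lintegral_exp_mul_std (t : ℝ) :
    ∫⁻ g, ENNReal.ofReal (Real.exp (t * g)) ∂gaussianReal 0 1 =
      ENNReal.ofReal (Real.exp (t ^ 2 / 2)) := by
  rw [← integral_exp_mul_std, ofReal_integral_eq_lintegral_ofReal (integrable_exp_mul_gaussianReal t)
    (ae_of_all _ fun g => Real.exp_nonneg _)]

lemma lintegral_exp_gaussianReal (m s l : ℝ) :
    ∫⁻ y, ENNReal.ofReal (Real.exp (l * (y - m) - l ^ 2 * s ^ 2 / 2))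
      ∂gaussianReal m (s ^ 2).toNNReal = 1 := by
  rw [lintegral_gaussianReal_eq_std _ _ (by fun_prop)]
  have : ∀ g, ENNReal.ofReal (Real.exp (l * (m + s * g - m) - l ^ 2 * s ^ 2 / 2)) =
      ENNReal.ofReal (Real.exp (-(l ^ 2 * s ^ 2 / 2))) *
        ENNReal.ofReal (Real.exp (l * s * g)) := by
    intro g
    rw [← ENNReal.ofReal_mul (Real.exp_nonneg _), ← Real.exp_add]
    ring_nf
  simp_rw [this]
  rw [lintegral_const_mul _ (by fun_prop), lintegral_exp_mul_std,
    ← ENNReal.ofReal_mul (Real.exp_nonneg _), ← Real.exp_add]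
  ring_nf
  simp

/-! ### A smooth version of the absolute value -/

/-- `√(1 + y ^ 2)`, a convex function that is close to `|y|` for large `|y|` and uniformly convex
near `0`. -/
noncomputable def smoothAbs (y : ℝ) : ℝ := √(1 + y ^ 2)

lemma smoothAbs_sq (y : ℝ) : smoothAbs y ^ 2 = 1 + y ^ 2 := Real.sq_sqrt (by positivity)

lemma one_le_smoothAbs (y : ℝ) : 1 ≤ smoothAbs y :=
  Real.le_sqrt_of_sq_le (by nlinarith [sq_nonneg y])

lemma abs_le_smoothAbs (y : ℝ) : |y| ≤ smoothAbs y :=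
  Real.le_sqrt_of_sq_le (by rw [sq_abs]; linarith)

lemma smoothAbs_le (y : ℝ) : smoothAbs y ≤ 1 + |y| := by
  rw [smoothAbs, Real.sqrt_le_left (by positivity)]
  nlinarith [abs_nonneg y, sq_abs y]

lemma abs_div_smoothAbs_le (y : ℝ) : |y / smoothAbs y| ≤ 1 := by
  have h := one_le_smoothAbs y
  rw [abs_div, abs_of_pos (by linarith : 0 < smoothAbs y)]
  exact div_le_one_of_le₀ (abs_le_smoothAbs y) (by linarith)

lemma measurable_smoothAbs : Measurable smoothAbs := by unfold smoothAbs; fun_prop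

lemma tangent_sq (y w : ℝ) : (smoothAbs y + y / smoothAbs y * w) ^ 2 =
    smoothAbs (y + w) ^ 2 - w ^ 2 / smoothAbs y ^ 2 := by
  have h := one_le_smoothAbs y
  have h1 := smoothAbs_sq y
  have h0 : smoothAbs y ≠ 0 := by linarith
  rw [smoothAbs_sq (y + w)]
  field_simp
  have : smoothAbs y ^ 4 = (1 + y ^ 2) ^ 2 := by rw [← h1]; ring
  nlinarith

lemma smoothAbs_add_ge (y w : ℝ) : smoothAbs y + y / smoothAbs y * w ≤ smoothAbs (y + w) := by
  refine le_of_sq_le_sq ?_ (by linarith [one_le_smoothAbs (y + w)])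
  rw [tangent_sq]
  have : 0 ≤ w ^ 2 / smoothAbs y ^ 2 := by positivity
  linarith

lemma smoothAbs_le_add (y w : ℝ) : smoothAbs y ≤ smoothAbs (y + w) + |w| := by
  have h := smoothAbs_add_ge y w
  have h1 := abs_div_smoothAbs_le y
  have h2 : -(y / smoothAbs y * w) ≤ |w| := by
    calc -(y / smoothAbs y * w) ≤ |y / smoothAbs y * w| := neg_le_abs _
      _ = |y / smoothAbs y| * |w| := abs_mul _ _
      _ ≤ 1 * |w| := by gcongr
      _ = |w| := one_mul _
  linarith

/-- Uniform convexity of `smoothAbs` near `0`. -/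
lemma smoothAbs_add_ge_of_abs_le {y : ℝ} (hy : |y| ≤ 1) (w : ℝ) :
    smoothAbs y + y / smoothAbs y * w + min (w ^ 2) 1 / 12 ≤ smoothAbs (y + w) := by
  set L := smoothAbs y + y / smoothAbs y * w with hL
  set m := min (w ^ 2) 1 / 12 with hm
  have hm0 : 0 ≤ m := by rw [hm]; positivity
  have hm1 : m ≤ w ^ 2 / 12 := by rw [hm]; gcongr; exact min_le_left _ _
  have hm2 : m ≤ 1 / 12 := by rw [hm]; gcongr; exact min_le_right _ _
  refine le_of_sq_le_sq ?_ (by linarith [one_le_smoothAbs (y + w)])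
  have hy2 : y ^ 2 ≤ 1 := (sq_le_one_iff_abs_le_one y).2 hy
  have hs2 : smoothAbs y ^ 2 ≤ 2 := by rw [smoothAbs_sq]; linarith
  have hs1 := one_le_smoothAbs y
  have hs : smoothAbs y ≤ 3 / 2 := by nlinarith
  have hLle : L ≤ 3 / 2 + |w| := by
    have h1 := abs_div_smoothAbs_le y
    have h2 : y / smoothAbs y * w ≤ |w| := by
      calc y / smoothAbs y * w ≤ |y / smoothAbs y * w| := le_abs_self _
        _ = |y / smoothAbs y| * |w| := abs_mul _ _
        _ ≤ 1 * |w| := by gcongr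
        _ = |w| := one_mul _
    linarith
  have hsq : L ^ 2 + w ^ 2 / smoothAbs y ^ 2 = smoothAbs (y + w) ^ 2 := by
    rw [hL, tangent_sq]; ring
  have hw : w ^ 2 / 2 ≤ w ^ 2 / smoothAbs y ^ 2 := by gcongr
  have hwm : |w| * m ≤ w ^ 2 / 12 := by
    rcases le_total |w| 1 with h | h
    · nlinarith [abs_nonneg w]
    · have : |w| ≤ w ^ 2 := by rw [← sq_abs]; nlinarith
      nlinarith [abs_nonneg w]
  have hLm : L * m ≤ 3 / 2 * m + |w| * m := by nlinarith
  nlinarith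

/-- By convexity, a Gaussian step of standard deviation `|v|` increases `exp (-δ * smoothAbs)` in
mean at most by a factor with exponent quadratic in `δ`. -/
lemma lintegral_exp_smoothAbs_le {δ : ℝ} (hδ : 0 ≤ δ) (y v : ℝ) :
    ∫⁻ g, ENNReal.ofReal (Real.exp (-δ * (smoothAbs (y + v * g) - smoothAbs y)))
      ∂gaussianReal 0 1 ≤ ENNReal.ofReal (Real.exp (2 * δ ^ 2 * v ^ 2)) := by
  calc ∫⁻ g, ENNReal.ofReal (Real.exp (-δ * (smoothAbs (y + v * g) - smoothAbs y)))
      ∂gaussianReal 0 1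
      ≤ ∫⁻ g, ENNReal.ofReal (Real.exp (-δ * (y / smoothAbs y) * v * g)) ∂gaussianReal 0 1 := by
        refine lintegral_mono fun g => ENNReal.ofReal_le_ofReal (Real.exp_le_exp.2 ?_)
        have := smoothAbs_add_ge y (v * g)
        nlinarith
    _ = ENNReal.ofReal (Real.exp ((-δ * (y / smoothAbs y) * v) ^ 2 / 2)) :=
        lintegral_exp_mul_std _
    _ ≤ _ := by
        refine ENNReal.ofReal_le_ofReal (Real.exp_le_exp.2 ?_)
        have h1 : (y / smoothAbs y) ^ 2 ≤ 1 :=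
          (sq_le_one_iff_abs_le_one _).2 (abs_div_smoothAbs_le y)
        have h2 : (-δ * (y / smoothAbs y) * v) ^ 2 = (δ ^ 2 * v ^ 2) * (y / smoothAbs y) ^ 2 := by
          rw [mul_pow, mul_pow, neg_sq]; ring
        rw [h2]
        nlinarith [mul_nonneg (sq_nonneg δ) (sq_nonneg v)]

/-- Near `0` uniform convexity yields a strict decrease, linear in `δ`. For small `δ` it dominates
the quadratic error term. -/
lemma exists_lintegral_exp_smoothAbs_le :
    ∃ c > 0, ∀ δ y v : ℝ, 0 ≤ δ → δ ≤ 1 / 2 → |y| ≤ 1 → |v| ≤ 1 →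
      ∫⁻ g, ENNReal.ofReal (Real.exp (-δ * (smoothAbs (y + v * g) - smoothAbs y)))
        ∂gaussianReal 0 1 ≤ ENNReal.ofReal (Real.exp (2 * δ ^ 2 * v ^ 2 - c * δ * v ^ 2)) := by
  have hint : Integrable (fun g : ℝ => min (g ^ 2) 1) (gaussianReal 0 1) := by
    refine Integrable.of_bound (by fun_prop) 1 (ae_of_all _ fun g => ?_)
    rw [Real.norm_of_nonneg (by positivity)]
    exact min_le_right _ _
  have hc0 : 0 < ∫ g : ℝ, min (g ^ 2) 1 ∂gaussianReal 0 1 := by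
    rw [integral_pos_iff_support_of_nonneg (fun g => by positivity) hint]
    have hsupp : (Function.support fun g : ℝ => min (g ^ 2) 1) = {0}ᶜ := by
      ext g
      simp only [Function.mem_support, Set.mem_compl_iff, Set.mem_singleton_iff]
      constructor
      · rintro h rfl; simp at h
      · intro h
        exact (lt_min (by positivity) one_pos).ne'
    rw [hsupp, prob_compl_eq_one_sub (measurableSet_singleton 0)]
    have : NullSingletonClass (gaussianReal 0 1) := nullSingletonClass_gaussianReal (by norm_num)
    rw [measure_singleton]
    simp
  set c₀ := ∫ g : ℝ, min (g ^ 2) 1 ∂gaussianReal 0 1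
  refine ⟨c₀ / 24, by positivity, fun δ y v hδ hδ1 hy hv => ?_⟩
  have hv2 : v ^ 2 ≤ 1 := (sq_le_one_iff_abs_le_one v).2 hv
  set t := y / smoothAbs y
  have ht : t ^ 2 ≤ 1 := (sq_le_one_iff_abs_le_one _).2 (abs_div_smoothAbs_le y)
  -- the linear and the quadratic term of the exponent are separated by `a * b ≤ (a² + b²) / 2`
  have hpt : ∀ g : ℝ, Real.exp (-δ * (smoothAbs (y + v * g) - smoothAbs y)) ≤
      1 / 2 * Real.exp (-2 * δ * t * v * g) + (1 / 2 - δ * v ^ 2 / 24 * min (g ^ 2) 1) := by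
    intro g
    have h1 := smoothAbs_add_ge_of_abs_le hy (v * g)
    have hmin : v ^ 2 * min (g ^ 2) 1 ≤ min ((v * g) ^ 2) 1 := by
      refine le_min ?_ ?_
      · rw [mul_pow]; gcongr; exact min_le_left _ _
      · have : min (g ^ 2) 1 ≤ 1 := min_le_right _ _
        have h0 : 0 ≤ min (g ^ 2) 1 := by positivity
        nlinarith [sq_nonneg v]
    set M := v ^ 2 * min (g ^ 2) 1
    have hM0 : 0 ≤ M := by positivity
    have hM1 : M ≤ 1 := hmin.trans (min_le_right _ _)
    have h2 : Real.exp (-δ * (smoothAbs (y + v * g) - smoothAbs y)) ≤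
        Real.exp (-δ * t * v * g) * Real.exp (-δ * M / 12) := by
      rw [← Real.exp_add]
      refine Real.exp_le_exp.2 ?_
      have : δ * (t * (v * g) + M / 12) ≤ δ * (smoothAbs (y + v * g) - smoothAbs y) := by
        gcongr
        linarith
      linarith
    have h3 : Real.exp (-δ * M / 12) ^ 2 ≤ 1 - δ * M / 12 := by
      rw [← Real.exp_nat_mul]
      have h4 : 0 ≤ δ * M := by positivity
      have h5 : δ * M ≤ 1 := by nlinarith
      have h7 : Real.exp (((2 : ℕ) : ℝ) * (-δ * M / 12)) = (Real.exp (δ * M / 6))⁻¹ := by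
        rw [← Real.exp_neg]; congr 1; push_cast; ring
      rw [h7, inv_le_comm₀ (Real.exp_pos _) (by linarith)]
      have h8 := Real.add_one_le_exp (δ * M / 6)
      refine le_trans ?_ h8
      rw [inv_le_comm₀ (by linarith) (by linarith), inv_le_comm₀ (by linarith) (by linarith),
        inv_eq_one_div, div_le_iff₀ (by linarith)]
      nlinarith
    have h4 : Real.exp (-δ * t * v * g) ^ 2 = Real.exp (-2 * δ * t * v * g) := by
      rw [← Real.exp_nat_mul]; congr 1; push_cast; ring
    have h5 : δ * v ^ 2 / 24 * min (g ^ 2) 1 = δ * M / 24 := by ring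
    rw [h5, ← h4]
    nlinarith [sq_nonneg (Real.exp (-δ * t * v * g) - Real.exp (-δ * M / 12))]
  have hi1 : Integrable (fun g : ℝ => 1 / 2 * Real.exp (-2 * δ * t * v * g)) (gaussianReal 0 1) :=
    (integrable_exp_mul_gaussianReal _).const_mul _
  have hi2 : Integrable (fun g : ℝ => 1 / 2 - δ * v ^ 2 / 24 * min (g ^ 2) 1)
      (gaussianReal 0 1) := (integrable_const _).sub (hint.const_mul _)
  calc ∫⁻ g, ENNReal.ofReal (Real.exp (-δ * (smoothAbs (y + v * g) - smoothAbs y)))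
        ∂gaussianReal 0 1
      ≤ ∫⁻ g, ENNReal.ofReal (1 / 2 * Real.exp (-2 * δ * t * v * g) +
          (1 / 2 - δ * v ^ 2 / 24 * min (g ^ 2) 1)) ∂gaussianReal 0 1 :=
        lintegral_mono fun g => ENNReal.ofReal_le_ofReal (hpt g)
    _ = ENNReal.ofReal (∫ g, (1 / 2 * Real.exp (-2 * δ * t * v * g) +
          (1 / 2 - δ * v ^ 2 / 24 * min (g ^ 2) 1)) ∂gaussianReal 0 1) :=
        (ofReal_integral_eq_lintegral_ofReal (hi1.add hi2)
          (ae_of_all _ fun g => (Real.exp_nonneg _).trans (hpt g))).symm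
    _ ≤ _ := by
        refine ENNReal.ofReal_le_ofReal ?_
        rw [integral_add hi1 hi2, integral_const_mul, integral_exp_mul_std,
          integral_sub (integrable_const _) (hint.const_mul _), integral_const_mul]
        simp only [integral_const, probReal_univ, smul_eq_mul, one_mul]
        have e1 : (-2 * δ * t * v) ^ 2 / 2 ≤ 2 * (δ ^ 2 * v ^ 2) := by
          have : (-2 * δ * t * v) ^ 2 / 2 = 2 * (δ ^ 2 * v ^ 2) * t ^ 2 := by ring
          rw [this]
          nlinarith [mul_nonneg (sq_nonneg δ) (sq_nonneg v)]
        have hd : δ ^ 2 * v ^ 2 ≤ 1 / 4 := by nlinarith [sq_nonneg δ, sq_nonneg v]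
        have hd0 : 0 ≤ δ ^ 2 * v ^ 2 := by positivity
        have e2 : Real.exp (2 * (δ ^ 2 * v ^ 2)) ≤ 1 + 4 * (δ ^ 2 * v ^ 2) := by
          have h6 := Real.exp_bound_div_one_sub_of_interval (x := 2 * (δ ^ 2 * v ^ 2))
            (by positivity) (by linarith)
          refine h6.trans ?_
          rw [div_le_iff₀ (by linarith)]
          nlinarith
        have e3 := (Real.exp_le_exp.2 e1).trans e2
        have e4 := Real.add_one_le_exp (2 * δ ^ 2 * v ^ 2 - c₀ / 24 * δ * v ^ 2)
        change 1 / 2 * Real.exp ((-2 * δ * t * v) ^ 2 / 2) + (1 / 2 - δ * v ^ 2 / 24 * c₀) ≤ _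
        nlinarith

/-! ### Concentration of the posterior means -/

section Concentration

variable {Ω : Type*} [MeasurableSpace Ω] {P : Measure Ω} {k : ℕ}
  {μ σ : Fin k → ℝ} {rule : Knowledge k → Fin k} {X : Fin k → ℕ → Ω → ℝ}

lemma pulls_eq_sum (x : Fin k → ℕ → ℝ) (i : Fin k) (n : ℕ) :
    (pulls σ rule x i n : ℝ) =
      ∑ u ∈ Finset.range n, if pulled σ rule x u = i then (1 : ℝ) else 0 := by
  rw [pulls, Finset.card_filter]
  push_cast
  rfl

/-- The deviation of the posterior mean of an arm on the event that the arm has been pulled exactly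
`n` times; `e = ± 1` is the sign of the deviation. -/
lemma measure_deviation_le [IsProbabilityMeasure P] (hσ : ∀ i, 0 < σ i)
    (hX : ∀ i n, Measurable (X i n))
    (hlaw : ∀ i n, P.map (X i n) = gaussianReal (μ i) (σ i ^ 2).toNNReal)
    (hindep : iIndepFun (fun p : Fin k × ℕ => X p.1 p.2) P) (hrule : Measurable rule)
    {e R : ℝ} (he : e ^ 2 = 1) (hR : 0 ≤ R) (j : Fin k) (u n : ℕ) (hn : 0 < n) :
    P {ω | pulls σ rule (fun i m => X i m ω) j u = n ∧
        R / √(n : ℝ) < e * (mean σ rule (fun i m => X i m ω) j u - μ j)} ≤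
      ENNReal.ofReal (Real.exp (-(R ^ 2 / (2 * σ j ^ 2)))) := by
  have hs := hσ j
  have hn' : (0 : ℝ) < n := by exact_mod_cast hn
  -- the Chernoff parameter that is optimal for `n` pulls
  set l := e * R / (√(n : ℝ) * σ j ^ 2) with hl
  have hsq : √(n : ℝ) ^ 2 = n := Real.sq_sqrt hn'.le
  have hsqpos : 0 < √(n : ℝ) := Real.sqrt_pos.2 hn'
  refine le_trans (measure_mono fun ω hω => ?_) (measure_le_sum_le hX hlaw hindep hrule
    (φ := fun v x y => if pulled σ rule x v = j then l * (y - μ j) - l ^ 2 * σ j ^ 2 / 2 else 0)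
    (fun v => ?_) (fun v x y => ?_) (fun v x => ?_) u (R ^ 2 / (2 * σ j ^ 2)))
  · obtain ⟨h1, h2⟩ := hω
    set x : Fin k → ℕ → ℝ := fun i m => X i m ω with hx
    change _ ≤ ∑ v ∈ Finset.range u, if pulled σ rule x v = j then
      l * (x (pulled σ rule x v) v - μ j) - l ^ 2 * σ j ^ 2 / 2 else 0
    have h3 : ∑ v ∈ Finset.range u, (if pulled σ rule x v = j then
        l * (x (pulled σ rule x v) v - μ j) - l ^ 2 * σ j ^ 2 / 2 else 0) =
        l * (n * (mean σ rule x j u - μ j)) - n * (l ^ 2 * σ j ^ 2 / 2) := by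
      rw [← h1, pulls_mul_mean_sub hσ, pulls_eq_sum, Finset.mul_sum, Finset.sum_mul,
        ← Finset.sum_sub_distrib]
      refine Finset.sum_congr rfl fun v _ => ?_
      split_ifs with hv
      · rw [hv]; ring
      · simp
    rw [h3]
    have h4 : n * (l ^ 2 * σ j ^ 2 / 2) = R ^ 2 / (2 * σ j ^ 2) := by
      rw [hl, div_pow, mul_pow, mul_pow, he, hsq]
      field_simp
    have h5 : R ^ 2 / σ j ^ 2 ≤ l * (n * (mean σ rule x j u - μ j)) := by
      calc R ^ 2 / σ j ^ 2 = R * n / (√(n : ℝ) * σ j ^ 2) * (R / √(n : ℝ)) := by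
            field_simp; rw [hsq]
        _ ≤ R * n / (√(n : ℝ) * σ j ^ 2) * (e * (mean σ rule x j u - μ j)) := by gcongr
        _ = l * (n * (mean σ rule x j u - μ j)) := by rw [hl]; ring
    have h6 : R ^ 2 / σ j ^ 2 = R ^ 2 / (2 * σ j ^ 2) + R ^ 2 / (2 * σ j ^ 2) := by
      field_simp; ring
    linarith
  · refine Measurable.ite ?_ (by fun_prop) measurable_const
    exact measurable_fst (measurable_pulled hrule v (measurableSet_singleton j))
  · simp only [pulled_trunc x le_rfl]
  · by_cases h : pulled σ rule x v = j
    · simp only [h, if_true]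
      exact (lintegral_exp_gaussianReal _ _ _).le
    · simp [h]

lemma measure_not_concentrated_le [IsProbabilityMeasure P] (hσ : ∀ i, 0 < σ i) {hi : ℝ}
    (hσhi : ∀ i, σ i ≤ hi) (hX : ∀ i n, Measurable (X i n))
    (hlaw : ∀ i n, P.map (X i n) = gaussianReal (μ i) (σ i ^ 2).toNNReal)
    (hindep : iIndepFun (fun p : Fin k × ℕ => X p.1 p.2) P) (hrule : Measurable rule) (s : ℕ) :
    P {ω | ¬ Concentrated μ σ rule (fun i m => X i m ω) s} ≤
      ENNReal.ofReal (2 * k * (s + 1) ^ 2 * Real.exp (-(root s ^ 4 / (2 * hi ^ 2)))) := by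
  set E : ℕ × Fin k × ℕ × Bool → Set Ω := fun p =>
    {ω | pulls σ rule (fun i m => X i m ω) p.2.1 p.1 = p.2.2.1 + 1 ∧
      root s ^ 2 / √((p.2.2.1 + 1 : ℕ) : ℝ) < (if p.2.2.2 then 1 else -1) *
        (mean σ rule (fun i m => X i m ω) p.2.1 p.1 - μ p.2.1)}
  set I := (Finset.range (s + 1)) ×ˢ (Finset.univ : Finset (Fin k)) ×ˢ
    (Finset.range (s + 1)) ×ˢ (Finset.univ : Finset Bool)
  have hsub : {ω | ¬ Concentrated μ σ rule (fun i m => X i m ω) s} ⊆ ⋃ p ∈ I, E p := by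
    intro ω hω
    simp only [Concentrated, Set.mem_ofPred_eq] at hω
    push Not at hω
    obtain ⟨u, hu, j, hpos, hlt⟩ := hω
    have hle := pulls_le (σ := σ) (rule := rule) (x := fun i m => X i m ω) j u
    have hN : pulls σ rule (fun i m => X i m ω) j u - 1 + 1 =
      pulls σ rule (fun i m => X i m ω) j u := by omega
    simp only [Set.mem_iUnion]
    rcases lt_abs.1 hlt with h | h
    · refine ⟨(u, j, pulls σ rule (fun i m => X i m ω) j u - 1, true), ?_, ?_⟩
      · simp only [I, Finset.mem_product, Finset.mem_range, Finset.mem_univ, and_true, true_and]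
        omega
      · simp only [E, Set.mem_ofPred_eq, hN, if_true, one_mul, true_and]
        exact h
    · refine ⟨(u, j, pulls σ rule (fun i m => X i m ω) j u - 1, false), ?_, ?_⟩
      · simp only [I, Finset.mem_product, Finset.mem_range, Finset.mem_univ, and_true, true_and]
        omega
      · simp only [E, Set.mem_ofPred_eq, hN, true_and, Bool.false_eq_true, if_false, neg_mul,
          one_mul]
        exact h
  have hE : ∀ p, P (E p) ≤ ENNReal.ofReal (Real.exp (-(root s ^ 4 / (2 * hi ^ 2)))) := by
    intro p
    refine (measure_deviation_le hσ hX hlaw hindep hrule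
      (e := if p.2.2.2 then 1 else -1) (by split_ifs <;> norm_num)
      (pow_nonneg (root_nonneg s) 2) p.2.1 p.1 (p.2.2.1 + 1) (by omega)).trans ?_
    refine ENNReal.ofReal_le_ofReal (Real.exp_le_exp.2 (neg_le_neg ?_))
    have h1 := hσ p.2.1
    have h2 := hσhi p.2.1
    have h3 := root_nonneg s
    rw [← pow_mul]
    gcongr
  calc _ ≤ P (⋃ p ∈ I, E p) := measure_mono hsub
    _ ≤ ∑ p ∈ I, P (E p) := measure_biUnion_finset_le _ _
    _ ≤ ∑ _p ∈ I, ENNReal.ofReal (Real.exp (-(root s ^ 4 / (2 * hi ^ 2)))) :=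
        Finset.sum_le_sum fun p _ => hE p
    _ = _ := by
        rw [Finset.sum_const, nsmul_eq_mul, ← ENNReal.ofReal_natCast,
          ← ENNReal.ofReal_mul (Nat.cast_nonneg _)]
        congr 2
        simp only [I, Finset.card_product, Finset.card_range, Finset.card_univ, Fintype.card_fin,
          Fintype.card_bool]
        push_cast
        ring

end Concentration

/-! ### Two arms with equal means do not stay close for long -/

section Ties

variable {Ω : Type*} [MeasurableSpace Ω] {P : Measure Ω} {k : ℕ}
  {μ σ : Fin k → ℝ} {rule : Knowledge k → Fin k} {X : Fin k → ℕ → Ω → ℝ}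

/-- The increment in round `u + 1` of `smoothAbs` of the difference of the posterior means of the
arms `i` and `j`, on the scale `η`, when both arms have at least `κ * s` pulls. The reward enters
relative to its true mean, so that the step is centred; the difference to the true step is a drift
of lower order. -/
noncomputable def tieIncr (μ σ : Fin k → ℝ) (rule : Knowledge k → Fin k) (i j : Fin k) (κ η : ℝ)
    (s u : ℕ) (x : Fin k → ℕ → ℝ) (y : ℝ) : ℝ :=
  if κ * s ≤ pulls σ rule x i u ∧ κ * s ≤ pulls σ rule x j u then
    if pulled σ rule x u = i then
      smoothAbs ((mean σ rule x i u - mean σ rule x j u) / η +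
        1 / ((pulls σ rule x i u + 1) * η) * (y - μ i)) -
        smoothAbs ((mean σ rule x i u - mean σ rule x j u) / η)
    else if pulled σ rule x u = j then
      smoothAbs ((mean σ rule x i u - mean σ rule x j u) / η +
        -(1 / ((pulls σ rule x j u + 1) * η)) * (y - μ j)) -
        smoothAbs ((mean σ rule x i u - mean σ rule x j u) / η)
    else 0
  else 0

/-- The compensator of `tieIncr`: an error `e` in every round in which `i` or `j` is pulled, and a
gain `a` whenever `i` is pulled while the posterior means are within `η`. -/
noncomputable def tieComp (σ : Fin k → ℝ) (rule : Knowledge k → Fin k) (i j : Fin k) (κ η e a : ℝ)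
    (s u : ℕ) (x : Fin k → ℕ → ℝ) : ℝ :=
  if κ * s ≤ pulls σ rule x i u ∧ κ * s ≤ pulls σ rule x j u then
    if pulled σ rule x u = i then
      if |mean σ rule x i u - mean σ rule x j u| ≤ η then e - a else e
    else if pulled σ rule x u = j then e else 0
  else 0

lemma measurable_tieIncr (hrule : Measurable rule) (i j : Fin k) (κ η : ℝ) (s u : ℕ) :
    Measurable (Function.uncurry (tieIncr μ σ rule i j κ η s u)) := by
  have hN : ∀ i, Measurable fun x : Fin k → ℕ → ℝ => (pulls σ rule x i u : ℝ) := fun i =>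
    measurable_from_top.comp (measurable_pulls hrule i u)
  have hN1 : ∀ i, Measurable fun p : (Fin k → ℕ → ℝ) × ℝ => (pulls σ rule p.1 i u : ℝ) :=
    fun i => (hN i).comp measurable_fst
  have hm1 : ∀ i, Measurable fun p : (Fin k → ℕ → ℝ) × ℝ => mean σ rule p.1 i u :=
    fun i => (measurable_mean hrule i u).comp measurable_fst
  have hp : ∀ i, MeasurableSet {p : (Fin k → ℕ → ℝ) × ℝ | pulled σ rule p.1 u = i} :=
    fun i => measurable_fst (measurable_pulled hrule u (measurableSet_singleton i))
  have hi := hm1 i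
  have hj := hm1 j
  have hNi := hN1 i
  have hNj := hN1 j
  refine Measurable.ite ((measurableSet_le measurable_const (hN1 i)).inter
    (measurableSet_le measurable_const (hN1 j))) (Measurable.ite (hp i) ?_
      (Measurable.ite (hp j) ?_ measurable_const)) measurable_const
  · exact (measurable_smoothAbs.comp (by fun_prop)).sub (measurable_smoothAbs.comp (by fun_prop))
  · exact (measurable_smoothAbs.comp (by fun_prop)).sub (measurable_smoothAbs.comp (by fun_prop))

lemma measurable_tieComp (hrule : Measurable rule) (i j : Fin k) (κ η e a : ℝ) (s u : ℕ) :
    Measurable (tieComp σ rule i j κ η e a s u) := by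
  have hN : ∀ i, Measurable fun x : Fin k → ℕ → ℝ => (pulls σ rule x i u : ℝ) := fun i =>
    measurable_from_top.comp (measurable_pulls hrule i u)
  have hp : ∀ i, MeasurableSet {x : Fin k → ℕ → ℝ | pulled σ rule x u = i} :=
    fun i => measurable_pulled hrule u (measurableSet_singleton i)
  have hi := measurable_mean (σ := σ) hrule i u
  have hj := measurable_mean (σ := σ) hrule j u
  refine Measurable.ite ((measurableSet_le measurable_const (hN i)).inter
    (measurableSet_le measurable_const (hN j))) (Measurable.ite (hp i)
      (Measurable.ite ?_ measurable_const measurable_const)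
      (Measurable.ite (hp j) measurable_const measurable_const)) measurable_const
  exact measurableSet_le (by fun_prop) measurable_const

lemma lintegral_exp_smoothAbs_sub_le_one (m t δ y c e : ℝ)
    (h : ∫⁻ g, ENNReal.ofReal (Real.exp (-δ * (smoothAbs (y + c * t * g) - smoothAbs y)))
      ∂gaussianReal 0 1 ≤ ENNReal.ofReal (Real.exp e)) :
    ∫⁻ z, ENNReal.ofReal (Real.exp (-δ * (smoothAbs (y + c * (z - m)) - smoothAbs y) - e))
      ∂gaussianReal m (t ^ 2).toNNReal ≤ 1 := by
  have hm := measurable_smoothAbs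
  have hmeas : Measurable fun g => ENNReal.ofReal
      (Real.exp (-δ * (smoothAbs (y + c * t * g) - smoothAbs y))) := by fun_prop
  rw [lintegral_gaussianReal_eq_std _ _ (by fun_prop)]
  have h1 : ∀ g, ENNReal.ofReal
      (Real.exp (-δ * (smoothAbs (y + c * (m + t * g - m)) - smoothAbs y) - e)) =
      ENNReal.ofReal (Real.exp (-e)) *
        ENNReal.ofReal (Real.exp (-δ * (smoothAbs (y + c * t * g) - smoothAbs y))) := by
    intro g
    rw [← ENNReal.ofReal_mul (Real.exp_nonneg _), ← Real.exp_add]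
    ring_nf
  simp_rw [h1]
  rw [lintegral_const_mul _ hmeas]
  calc _ ≤ ENNReal.ofReal (Real.exp (-e)) * ENNReal.ofReal (Real.exp e) := by gcongr
    _ = 1 := by
      rw [← ENNReal.ofReal_mul (Real.exp_nonneg _), ← Real.exp_add]
      simp

/-- Telescoping: along a concentrated trajectory the increments add up to at most the present value
of `smoothAbs`, up to the accumulated drift. -/
lemma sum_tieIncr_le (hσ : ∀ i, 0 < σ i) {i j : Fin k} (hij : i ≠ j) {κ η τ : ℝ} (hη : 0 < η)
    (hτ : 0 ≤ τ) {s : ℕ} {x : Fin k → ℕ → ℝ}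
    (hdrift : ∀ u ≤ s, ∀ a, κ * s ≤ pulls σ rule x a u →
      |mean σ rule x a u - μ a| / ((pulls σ rule x a u + 1) * η) ≤ τ) (n : ℕ) (hn : n ≤ s) :
    ∑ u ∈ Finset.range n, tieIncr μ σ rule i j κ η s u x (x (pulled σ rule x u) u) ≤
      (if κ * s ≤ pulls σ rule x i n ∧ κ * s ≤ pulls σ rule x j n then
        smoothAbs ((mean σ rule x i n - mean σ rule x j n) / η) else 0) + n * τ := by
  induction n with
  | zero =>
    simp only [Finset.range_zero, Finset.sum_empty, Nat.cast_zero, zero_mul, add_zero]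
    split_ifs
    · linarith [one_le_smoothAbs ((mean σ rule x i 0 - mean σ rule x j 0) / η)]
    · exact le_rfl
  | succ n ih =>
    have ih := ih (by omega)
    rw [Finset.sum_range_succ]
    push_cast
    by_cases hact : κ * s ≤ pulls σ rule x i n ∧ κ * s ≤ pulls σ rule x j n
    · have hact' : κ * s ≤ pulls σ rule x i (n + 1) ∧ κ * s ≤ pulls σ rule x j (n + 1) :=
        ⟨hact.1.trans (by exact_mod_cast pulls_mono i (Nat.le_succ n)),
          hact.2.trans (by exact_mod_cast pulls_mono j (Nat.le_succ n))⟩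
      rw [if_pos hact] at ih
      rw [if_pos hact', tieIncr, if_pos hact, mean_succ hσ, mean_succ hσ]
      by_cases hi : pulled σ rule x n = i
      · rw [if_pos hi, if_pos hi, if_neg (by rw [hi]; exact hij), hi]
        have hd := hdrift n (by omega) i hact.1
        have hN : (0 : ℝ) < pulls σ rule x i n + 1 := by positivity
        have h := smoothAbs_le_add ((mean σ rule x i n - mean σ rule x j n) / η +
          1 / ((pulls σ rule x i n + 1) * η) * (x i n - μ i))
          (-((mean σ rule x i n - μ i) / ((pulls σ rule x i n + 1) * η)))
        rw [abs_neg, abs_div, abs_of_pos (mul_pos hN hη)] at h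
        have e : (mean σ rule x i n - mean σ rule x j n) / η +
          1 / ((pulls σ rule x i n + 1) * η) * (x i n - μ i) +
          -((mean σ rule x i n - μ i) / ((pulls σ rule x i n + 1) * η)) =
          (mean σ rule x i n + (x i n - mean σ rule x i n) / (pulls σ rule x i n + 1) -
            mean σ rule x j n) / η := by field_simp; ring
        rw [e] at h
        linarith
      · rw [if_neg hi, if_neg hi]
        by_cases hj : pulled σ rule x n = j
        · rw [if_pos hj, if_pos hj, hj]
          have hd := hdrift n (by omega) j hact.2
          have hN : (0 : ℝ) < pulls σ rule x j n + 1 := by positivity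
          have h := smoothAbs_le_add ((mean σ rule x i n - mean σ rule x j n) / η +
            -(1 / ((pulls σ rule x j n + 1) * η)) * (x j n - μ j))
            ((mean σ rule x j n - μ j) / ((pulls σ rule x j n + 1) * η))
          rw [abs_div, abs_of_pos (mul_pos hN hη)] at h
          have e : (mean σ rule x i n - mean σ rule x j n) / η +
            -(1 / ((pulls σ rule x j n + 1) * η)) * (x j n - μ j) +
            ((mean σ rule x j n - μ j) / ((pulls σ rule x j n + 1) * η)) =
            (mean σ rule x i n - (mean σ rule x j n +
              (x j n - mean σ rule x j n) / (pulls σ rule x j n + 1))) / η := by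
            field_simp; ring
          rw [e] at h
          linarith
        · rw [if_neg hj, if_neg hj]
          linarith
    · rw [if_neg hact] at ih
      rw [tieIncr, if_neg hact]
      split_ifs
      · linarith [one_le_smoothAbs ((mean σ rule x i (n + 1) - mean σ rule x j (n + 1)) / η)]
      · linarith

lemma sum_tieComp_le {i j : Fin k} {κ C e a : ℝ} (he : 0 ≤ e) (s : ℕ) (x : Fin k → ℕ → ℝ) :
    ∑ u ∈ Finset.range s, tieComp σ rule i j κ (C / root s ^ 10) e a s u x ≤
      s * e - (tiedRounds σ rule κ C x i j s).card * a := by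
  classical
  have h : ∀ u ∈ Finset.range s, tieComp σ rule i j κ (C / root s ^ 10) e a s u x ≤
      e - if pulled σ rule x u = i ∧ κ * s ≤ pulls σ rule x i u ∧
    κ * s ≤ pulls σ rule x j u ∧ |mean σ rule x i u - mean σ rule x j u| ≤ C / root s ^ 10
      then a else 0 := by
    intro u _
    unfold tieComp
    split_ifs <;> first | linarith | (exfalso; tauto)
  refine (Finset.sum_le_sum h).trans (le_of_eq ?_)
  rw [Finset.sum_sub_distrib, Finset.sum_const, Finset.card_range, nsmul_eq_mul,
    ← Finset.sum_filter, Finset.sum_const, nsmul_eq_mul]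
  simp only [tiedRounds]

/-- On concentrated trajectories, two arms of equal means are tied in a positive fraction of the
rounds only with a probability of at most `exp (-c * s ^ (3 / 7))`. The total gain of the compensator
is of order `s ^ (3 / 7)`, whereas the final value of `smoothAbs` and the drift are of order
`s ^ (5 / 14)`. -/
lemma exists_measure_tied_le [IsProbabilityMeasure P] (hσ : ∀ i, 0 < σ i) (hk : 0 < k)
    (hX : ∀ i n, Measurable (X i n))
    (hlaw : ∀ i n, P.map (X i n) = gaussianReal (μ i) (σ i ^ 2).toNNReal)
    (hindep : iIndepFun (fun p : Fin k × ℕ => X p.1 p.2) P) (hrule : Measurable rule)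
    {κ C : ℝ} (hκ : 0 < κ) (hC : 0 < C) :
    ∃ c > 0, ∀ᶠ s : ℕ in atTop, ∀ i j, i ≠ j → μ i = μ j →
      P {ω | Concentrated μ σ rule (fun i m => X i m ω) s ∧
        (s : ℝ) / (4 * k ^ 2) ≤ (tiedRounds σ rule κ C (fun i m => X i m ω) i j s).card} ≤
      ENNReal.ofReal (Real.exp (-(c * root s ^ 6))) := by
  have : Nonempty (Fin k) := ⟨⟨0, hk⟩⟩
  obtain ⟨i₀, hi₀⟩ := Finite.exists_min σ
  obtain ⟨i₁, hi₁⟩ := Finite.exists_max σ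
  set lo := σ i₀
  set hi := σ i₁
  have hlo : 0 < lo := hσ _
  have hhi : 0 < hi := hσ _
  have hk0 : (0 : ℝ) < k := by exact_mod_cast hk
  obtain ⟨c₀, hc₀, hstep⟩ := exists_lintegral_exp_smoothAbs_le
  -- `δ` is so small that the gain beats the quadratic error term by a factor `2`
  set δ := min (1 / 2) (c₀ * lo ^ 2 * κ ^ 2 / (64 * k ^ 2 * hi ^ 2)) with hδ
  have hδ0 : 0 < δ := lt_min (by norm_num) (by positivity)
  have hδ1 : δ ≤ 1 / 2 := min_le_left _ _
  have hδ2 : 64 * k ^ 2 * hi ^ 2 * δ ≤ c₀ * lo ^ 2 * κ ^ 2 := by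
    have : δ ≤ c₀ * lo ^ 2 * κ ^ 2 / (64 * k ^ 2 * hi ^ 2) := min_le_right _ _
    rw [le_div_iff₀ (by positivity)] at this
    linarith
  set c₁ := δ * c₀ * lo ^ 2 / (64 * k ^ 2 * C ^ 2) with hc₁
  have hc₁0 : 0 < c₁ := by positivity
  set A := (√κ)⁻¹ / (κ * C) with hA
  set B := 2 * (√κ)⁻¹ / C with hB
  have hA0 : 0 < A := by positivity
  have hB0 : 0 < B := by positivity
  refine ⟨c₁, hc₁0, ?_⟩
  filter_upwards [tendsto_root.eventually_ge_atTop 1, eventually_gt_atTop 0,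
    eventually_mul_root_pow_le (δ * (1 + A + B)) hc₁0 (show 5 < 6 by norm_num),
    eventually_mul_root_pow_le (hi / (κ * C)) one_pos (show 0 < 4 by norm_num)]
    with s hp1 hs0 hdom hV1 i j hij hμ
  have hp0 : 0 < root s := by linarith
  have hps := root_pow s
  have hs : (0 : ℝ) < s := by exact_mod_cast hs0
  set p := root s with hp
  set η := C / p ^ 10 with hη
  have hη0 : 0 < η := by positivity
  -- bounds for the standard deviation of one step on the scale `η`
  set V := hi / (κ * C * p ^ 4) with hV
  set w := lo / (2 * C * p ^ 4) with hw
  have hVle : V ≤ 1 := by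
    rw [hV, div_le_one (by positivity)]
    rw [pow_zero, mul_one, one_mul, div_le_iff₀ (by positivity)] at hV1
    linarith
  have hκη : κ * s * η = κ * C * p ^ 4 := by rw [← hps, hη]; field_simp
  have hsη : 2 * s * η = 2 * C * p ^ 4 := by rw [← hps, hη]; field_simp
  set e := 2 * δ ^ 2 * V ^ 2 with he
  set a := c₀ * δ * w ^ 2 with ha
  have hupper : ∀ (b : Fin k) (N : ℝ), κ * s ≤ N → (1 / ((N + 1) * η) * σ b) ^ 2 ≤ V ^ 2 := by
    intro b N hN
    have h1 := hσ b
    have h2 := hi₁ b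
    have hN0 : 0 < N := lt_of_lt_of_le (by positivity) hN
    have : 1 / ((N + 1) * η) * σ b ≤ V := by
      rw [hV, ← hκη, one_div_mul_eq_div]
      gcongr
      linarith
    gcongr
  have hlower : ∀ (b : Fin k) (N : ℝ), 0 ≤ N → N + 1 ≤ 2 * s →
      w ^ 2 ≤ (1 / ((N + 1) * η) * σ b) ^ 2 := by
    intro b N hN hN2
    have h1 := hσ b
    have h2 := hi₀ b
    have : w ≤ 1 / ((N + 1) * η) * σ b := by
      rw [hw, ← hsη, one_div_mul_eq_div]
      gcongr
    have : 0 ≤ w := by positivity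
    gcongr
  refine le_trans (measure_mono fun ω hω => ?_) (measure_le_sum_le hX hlaw hindep hrule
    (φ := fun u x y => if u < s then
      -δ * tieIncr μ σ rule i j κ η s u x y - tieComp σ rule i j κ η e a s u x else 0)
    (fun u => ?_) (fun u x y => ?_) (fun u x => ?_) s (c₁ * p ^ 6))
  · obtain ⟨hconc, hcard⟩ := hω
    set x : Fin k → ℕ → ℝ := fun i m => X i m ω with hx
    change _ ≤ ∑ u ∈ Finset.range s, if u < s then
      -δ * tieIncr μ σ rule i j κ η s u x (x (pulled σ rule x u) u) -
        tieComp σ rule i j κ η e a s u x else 0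
    have hsum : ∑ u ∈ Finset.range s, (if u < s then
        -δ * tieIncr μ σ rule i j κ η s u x (x (pulled σ rule x u) u) -
          tieComp σ rule i j κ η e a s u x else 0) =
        -δ * ∑ u ∈ Finset.range s, tieIncr μ σ rule i j κ η s u x (x (pulled σ rule x u) u) -
          ∑ u ∈ Finset.range s, tieComp σ rule i j κ η e a s u x := by
      rw [Finset.mul_sum, ← Finset.sum_sub_distrib]
      exact Finset.sum_congr rfl fun u hu => if_pos (Finset.mem_range.1 hu)
    rw [hsum]
    have hdev : ∀ u ≤ s, ∀ b, κ * s ≤ pulls σ rule x b u →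
        |mean σ rule x b u - μ b| ≤ (√κ)⁻¹ / p ^ 5 := fun u hu b hb =>
      hconc.abs_sub_le hκ hs0 hu hb
    have h1 := sum_tieIncr_le (rule := rule) (μ := μ) hσ hij (κ := κ) hη0 (τ := A / p ^ 9)
      (by positivity) (s := s) (x := x) (fun u hu b hb => by
        calc |mean σ rule x b u - μ b| / ((pulls σ rule x b u + 1) * η)
            ≤ (√κ)⁻¹ / p ^ 5 / (κ * s * η) := by
              gcongr
              · exact hdev u hu b hb
              · linarith
          _ = A / p ^ 9 := by rw [hκη, hA]; field_simp) s le_rfl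
    have h2 : (if κ * s ≤ pulls σ rule x i s ∧ κ * s ≤ pulls σ rule x j s then
        smoothAbs ((mean σ rule x i s - mean σ rule x j s) / η) else 0) ≤ 1 + B * p ^ 5 := by
      split_ifs with hact
      · refine (smoothAbs_le _).trans ?_
        rw [abs_div, abs_of_pos hη0]
        have hi' := hdev s le_rfl i hact.1
        have hj' := hdev s le_rfl j hact.2
        rw [← hμ] at hj'
        have hd : |mean σ rule x i s - mean σ rule x j s| ≤ 2 * ((√κ)⁻¹ / p ^ 5) := by
          have := abs_sub_le (mean σ rule x i s) (μ i) (mean σ rule x j s)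
          rw [abs_sub_comm (μ i)] at this
          linarith
        calc 1 + |mean σ rule x i s - mean σ rule x j s| / η
            ≤ 1 + 2 * ((√κ)⁻¹ / p ^ 5) / η := by gcongr
          _ = 1 + B * p ^ 5 := by rw [hη, hB]; field_simp
      · positivity
    have h3 := sum_tieComp_le (σ := σ) (rule := rule) (i := i) (j := j) (κ := κ) (C := C)
      (e := e) (a := a) (by positivity) s x
    have h4 : (s : ℝ) * (A / p ^ 9) = A * p ^ 5 := by rw [← hps]; field_simp
    have h5 : (s : ℝ) / (4 * k ^ 2) * a ≤ (tiedRounds σ rule κ C x i j s).card * a := by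
      gcongr
    have h6 : (s : ℝ) * e = p ^ 6 * (2 * δ ^ 2 * hi ^ 2 / (κ ^ 2 * C ^ 2)) := by
      rw [he, hV, ← hps]; field_simp
    have h7 : (s : ℝ) / (4 * k ^ 2) * a = p ^ 6 * (4 * c₁) := by
      rw [ha, hw, ← hps, hc₁]; field_simp; ring
    have h8 : 2 * δ ^ 2 * hi ^ 2 / (κ ^ 2 * C ^ 2) ≤ 2 * c₁ := by
      rw [hc₁, div_le_iff₀ (by positivity)]
      have : 2 * (δ * c₀ * lo ^ 2 / (64 * k ^ 2 * C ^ 2)) * (κ ^ 2 * C ^ 2) =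
          2 * δ / (64 * k ^ 2) * (c₀ * lo ^ 2 * κ ^ 2) := by field_simp
      rw [this]
      calc 2 * δ ^ 2 * hi ^ 2 = 2 * δ / (64 * k ^ 2) * (64 * k ^ 2 * hi ^ 2 * δ) := by
            field_simp
        _ ≤ _ := by gcongr
    have h9 : δ * (1 + B * p ^ 5 + A * p ^ 5) ≤ c₁ * p ^ 6 := by
      refine le_trans ?_ hdom
      have : 1 ≤ p ^ 5 := one_le_pow₀ hp1
      rw [mul_assoc]
      gcongr
      linarith
    have h10 : p ^ 6 * (2 * δ ^ 2 * hi ^ 2 / (κ ^ 2 * C ^ 2)) ≤ p ^ 6 * (2 * c₁) := by gcongr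
    have h11 : δ * ∑ u ∈ Finset.range s,
        tieIncr μ σ rule i j κ η s u x (x (pulled σ rule x u) u) ≤
        δ * (1 + B * p ^ 5 + A * p ^ 5) := by
      gcongr
      linarith
    linarith
  · split_ifs
    · exact ((measurable_tieIncr hrule i j κ η s u).const_mul (-δ)).sub
        ((measurable_tieComp hrule i j κ η e a s u).comp measurable_fst)
    · exact measurable_const
  · simp only [tieIncr, tieComp, pulls_trunc x _ le_rfl, pulled_trunc x le_rfl,
      mean_trunc x _ le_rfl]
  · by_cases hu : u < s
    · simp only [hu, if_true]
      unfold tieIncr tieComp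
      by_cases hact : κ * s ≤ pulls σ rule x i u ∧ κ * s ≤ pulls σ rule x j u
      · simp only [hact, and_self, if_true]
        by_cases hi' : pulled σ rule x u = i
        · simp only [hi', if_true]
          have hup := hupper i _ hact.1
          split_ifs with hD
          · refine lintegral_exp_smoothAbs_sub_le_one _ _ _ _ _ _ ((hstep δ _ _ hδ0.le hδ1 ?_
              ?_).trans (ENNReal.ofReal_le_ofReal (Real.exp_le_exp.2 ?_)))
            · rw [abs_div, abs_of_pos hη0]; exact div_le_one_of_le₀ hD hη0.le
            · rw [← sq_le_one_iff_abs_le_one]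
              refine hup.trans (pow_le_one₀ (by positivity) hVle)
            · have hNs : (pulls σ rule x i u : ℝ) + 1 ≤ 2 * s := by
                have : (pulls σ rule x i u : ℝ) + 1 ≤ s := by
                  exact_mod_cast lt_of_le_of_lt (pulls_le i u) hu
                linarith
              have hlw := hlower i _ (Nat.cast_nonneg _) hNs
              exact sub_le_sub (by rw [he]; gcongr) (by rw [ha]; gcongr)
          · refine lintegral_exp_smoothAbs_sub_le_one _ _ _ _ _ _
              ((lintegral_exp_smoothAbs_le hδ0.le _ _).trans
                (ENNReal.ofReal_le_ofReal (Real.exp_le_exp.2 ?_)))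
            rw [he]; gcongr
        · simp only [hi', if_false]
          by_cases hj' : pulled σ rule x u = j
          · simp only [hj', if_true]
            have hup := hupper j _ hact.2
            refine lintegral_exp_smoothAbs_sub_le_one _ _ _ _ _ _
              ((lintegral_exp_smoothAbs_le hδ0.le _ _).trans
                (ENNReal.ofReal_le_ofReal (Real.exp_le_exp.2 ?_)))
            rw [he, neg_mul, neg_sq]; gcongr
          · simp [hj']
      · simp [hact]
    · simp [hu]

end Ties

/-! ### Ratios of numbers of pulls -/

section Ratio

variable {k : ℕ} {μ σ : Fin k → ℝ} {rule : Knowledge k → Fin k} {x : Fin k → ℕ → ℝ}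

lemma exists_last_pull (i : Fin k) (s : ℕ) (h : 0 < pulls σ rule x i s) :
    ∃ w < s, pulled σ rule x w = i ∧ pulls σ rule x i w + 1 = pulls σ rule x i s := by
  induction s with
  | zero => simp at h
  | succ s ih =>
    rw [pulls_succ] at h ⊢
    by_cases hi : pulled σ rule x s = i
    · exact ⟨s, by omega, hi, by simp [hi]⟩
    · simp only [hi, if_false, add_zero] at h ⊢
      obtain ⟨w, hw, h1, h2⟩ := ih h
      exact ⟨w, by omega, h1, h2⟩

lemma iSup_ne_le_add (hk : 2 ≤ k) {θ ν : Fin k → ℝ} {r : ℝ} (h : ∀ j, θ j ≤ ν j + r) (i : Fin k) :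
    (⨆ j : {j : Fin k // j ≠ i}, θ j) ≤ (⨆ j : {j : Fin k // j ≠ i}, ν j) + r := by
  obtain ⟨l, hl, hsup⟩ := exists_iSup_ne_eq hk θ i
  rw [hsup]
  linarith [h l, le_iSup_ne ν hl]

lemma abs_gap_sub_gap_le (hk : 2 ≤ k) {θ ν : Fin k → ℝ} {r : ℝ} (h : ∀ j, |θ j - ν j| ≤ r)
    (i : Fin k) : |gap θ i - gap ν i| ≤ 2 * r := by
  have h' : ∀ j, -r ≤ θ j - ν j ∧ θ j - ν j ≤ r := fun j => abs_le.1 (h j)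
  have h1 := iSup_ne_le_add hk (θ := θ) (ν := ν) (r := r) (fun j => by linarith [(h' j).2]) i
  have h2 := iSup_ne_le_add hk (θ := ν) (ν := θ) (r := r) (fun j => by linarith [(h' j).1]) i
  refine (abs_abs_sub_abs_le _ _).trans (abs_le.2 ⟨?_, ?_⟩)
  · linarith [(h' i).1]
  · linarith [(h' i).2]

/-- The numbers of pulls are asymptotically proportional to `σ i / gap μ i`: the arm `i` is compared
with `j` at its last pull. -/
lemma eventually_pulls_ratio (hk : 2 ≤ k) (hσ : ∀ i, 0 < σ i) (hgap : ∀ i, 0 < gap μ i) {ε : ℝ}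
    (hε : 0 < ε) (hε1 : ε ≤ 1) :
    ∀ᶠ s : ℕ in atTop, ∀ (rule : Knowledge k → Fin k) (x : Fin k → ℕ → ℝ), IsKGRule σ rule →
      Concentrated μ σ rule x s →
      (∀ w : ℕ, ε / 2 * s ≤ w → w ≤ s → ∀ j, ε * w ≤ (pulls σ rule x j w : ℝ)) →
      ∀ i j, (gap μ i - (s : ℝ) ^ (-(1 / 4) : ℝ)) / σ i * pulls σ rule x i s ≤
        (gap μ j + (s : ℝ) ^ (-(1 / 4) : ℝ)) / σ j * pulls σ rule x j s := by
  have : Nonempty (Fin k) := ⟨⟨0, by omega⟩⟩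
  obtain ⟨i₀, hi₀⟩ := Finite.exists_min σ
  obtain ⟨i₁, hi₁⟩ := Finite.exists_max σ
  obtain ⟨i₂, hi₂⟩ := Finite.exists_min (gap μ)
  obtain ⟨i₃, hi₃⟩ := Finite.exists_max (gap μ)
  set lo := σ i₀
  set hi := σ i₁
  set g := gap μ i₂
  set G := gap μ i₃
  have hlo : 0 < lo := hσ _
  have hhi : 0 < hi := hσ _
  have hg : 0 < g := hgap _
  have hG : 0 < G := hgap _
  set c := ε ^ 2 / 2 with hc
  have hc0 : 0 < c := by positivity
  set A := (√c)⁻¹ with hA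
  have hA0 : 0 < A := by positivity
  set L := G / lo + (G + 1) / lo + 1 with hL
  filter_upwards [tendsto_root.eventually_ge_atTop 1,
    tendsto_natCast_atTop_atTop.eventually_ge_atTop (2 / ε),
    eventually_mul_root_pow_le (3 * A) one_pos (show 4 < 5 by norm_num),
    eventually_mul_root_pow_le A (B := min (g / 4) (1 / 2)) (lt_min (by positivity) (by norm_num))
      (show 0 < 5 by norm_num),
    eventually_mul_root_pow_le (2 * hi / (lo * c)) (B := g / 2 * c / hi) (by positivity)
      (show 0 < 14 by norm_num),
    eventually_mul_root_pow_le L (B := A * ε / hi) (by positivity) (show 0 < 9 by norm_num)]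
    with s hp1 hsε h1 h2 h3 h4 rule x hrule hconc hlin i j
  have hs0 : (0 : ℝ) < s := lt_of_lt_of_le (by positivity) hsε
  have hs0' : 0 < s := by exact_mod_cast hs0
  have hp0 : 0 < root s := by linarith
  have hps := root_pow s
  set p := root s with hp
  set r := A / p ^ 5 with hr
  have hr0 : 0 < r := by positivity
  have hrg : r ≤ min (g / 4) (1 / 2) := by
    rw [hr, div_le_iff₀ (by positivity)]; simpa using h2
  have hrg1 : r ≤ g / 4 := hrg.trans (min_le_left _ _)
  have hrg2 : r ≤ 1 / 2 := hrg.trans (min_le_right _ _)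
  set δ := (s : ℝ) ^ (-(1 / 4) : ℝ) with hδ
  have hrδ : 3 * r ≤ δ := by
    have e1 : 3 * r ≤ (p ^ 4)⁻¹ := by
      rw [hr, inv_eq_one_div, mul_div_assoc', div_le_div_iff₀ (by positivity) (by positivity)]
      linarith
    refine e1.trans ?_
    rw [hδ, Real.rpow_neg hs0.le]
    refine inv_anti₀ (by positivity) ?_
    rw [hp, root, ← Real.rpow_natCast, ← Real.rpow_mul hs0.le]
    refine Real.rpow_le_rpow_of_exponent_le (by exact_mod_cast hs0') ?_
    norm_num
  have hNs : ∀ a, ε * s ≤ (pulls σ rule x a s : ℝ) := hlin s (by nlinarith) le_rfl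
  obtain ⟨w, hws, hwi, hwN⟩ := exists_last_pull i s (by
    have := lt_of_lt_of_le (mul_pos hε hs0) (hNs i)
    exact_mod_cast this)
  have hws' : (w : ℝ) ≤ s := by exact_mod_cast hws.le
  have hwN' : (pulls σ rule x i w : ℝ) + 1 = pulls σ rule x i s := by exact_mod_cast hwN
  have hw : ε / 2 * s ≤ w := by
    have e1 : (pulls σ rule x i w : ℝ) ≤ w := by exact_mod_cast pulls_le i w
    have e2 := hNs i
    rw [div_le_iff₀ hε] at hsε
    linarith
  have hNw : ∀ a, c * s ≤ (pulls σ rule x a w : ℝ) := fun a => by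
    refine le_trans ?_ (hlin w hw hws.le a)
    calc c * s = ε * (ε / 2 * s) := by rw [hc]; ring
      _ ≤ ε * w := by gcongr
  have hdev : ∀ a, |mean σ rule x a w - μ a| ≤ r := fun a =>
    hconc.abs_sub_le hc0 hs0' hws.le (hNw a)
  have hgi := abs_le.1 (abs_gap_sub_gap_le hk (θ := fun a => mean σ rule x a w) hdev i)
  have hgj := abs_le.1 (abs_gap_sub_gap_le hk (θ := fun a => mean σ rule x a w) hdev j)
  have hNi0 : (0 : ℝ) < pulls σ rule x i w := lt_of_lt_of_le (by positivity) (hNw i)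
  have hgj2 : g / 2 ≤ gap (fun a => mean σ rule x a w) j := by linarith [hi₂ j]
  have hσi := hσ i
  have hσj := hσ j
  have key := gap_mul_le_of_pulled hrule hσ hwi (by exact_mod_cast hNi0) j (by
    have e1 : σ i / pulls σ rule x i w ≤ hi / (c * s) := by
      have := hi₁ i
      have := hNw i
      gcongr
    have e2 : lo / (2 * s) ≤ σ j / (pulls σ rule x j w + 1) := by
      have h5 := hi₀ j
      have h6 : (pulls σ rule x j w : ℝ) + 1 ≤ 2 * s := by
        have : (pulls σ rule x j w : ℝ) ≤ w := by exact_mod_cast pulls_le j w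
        have : (1 : ℝ) ≤ s := by exact_mod_cast hs0'
        linarith
      gcongr
    have e3 : 2 * hi / (lo * c) ≤
        Real.exp (gap (fun l => mean σ rule x l w) j * pulls σ rule x j w / σ j) := by
      have e4 : g / 2 * (c * s) / hi ≤
          gap (fun l => mean σ rule x l w) j * pulls σ rule x j w / σ j := by
        have := hi₁ j
        have := hNw j
        have := gap_nonneg (fun l => mean σ rule x l w) j
        gcongr
      have e5 := Real.add_one_le_exp
        (gap (fun l => mean σ rule x l w) j * pulls σ rule x j w / σ j)
      have e6 : g / 2 * (c * s) / hi = g / 2 * c / hi * p ^ 14 := by rw [hps]; ring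
      linarith
    calc σ i / pulls σ rule x i w ≤ hi / (c * s) := e1
      _ = 2 * hi / (lo * c) * (lo / (2 * s)) := by field_simp
      _ ≤ _ := by gcongr)
  have f1 : (gap μ i - 2 * r) * pulls σ rule x i w / σ i ≤
      gap (fun a => mean σ rule x a w) i * pulls σ rule x i w / σ i := by
    gcongr
    linarith
  have f2 : gap (fun l => mean σ rule x l w) j * (pulls σ rule x j w + 1) / σ j ≤
      (gap μ j + 2 * r) * (pulls σ rule x j s + 1) / σ j := by
    have h5 : (pulls σ rule x j w : ℝ) ≤ pulls σ rule x j s := by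
      exact_mod_cast pulls_mono j hws.le
    have h6 := gap_nonneg μ j
    gcongr
    linarith
  have f3 : (gap μ i - 2 * r) / σ i ≤ G / lo := by
    have h5 := hi₃ i
    have h6 := hi₀ i
    gcongr
    linarith
  have f4 : (gap μ j + 2 * r) / σ j ≤ (G + 1) / lo := by
    have h5 := hi₃ j
    have h6 := hi₀ j
    gcongr
    linarith
  have f5 : L ≤ r / σ j * pulls σ rule x j s := by
    calc L ≤ A * ε / hi * p ^ 9 := by simpa using h4
      _ = r / hi * (ε * s) := by rw [hr, ← hps]; field_simp
      _ ≤ r / σ j * pulls σ rule x j s := by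
        have := hi₁ j
        have := hNs j
        gcongr
  have f6 : (gap μ i - 2 * r) * pulls σ rule x i w / σ i =
      (gap μ i - 2 * r) / σ i * pulls σ rule x i s - (gap μ i - 2 * r) / σ i := by
    rw [← hwN']; ring
  have f7 : (gap μ j + 2 * r) * (pulls σ rule x j s + 1) / σ j =
      (gap μ j + 2 * r) / σ j * pulls σ rule x j s + (gap μ j + 2 * r) / σ j := by ring
  calc (gap μ i - δ) / σ i * pulls σ rule x i s
      ≤ (gap μ i - 2 * r) / σ i * pulls σ rule x i s := by gcongr; linarith
    _ ≤ (gap μ j + 2 * r) / σ j * pulls σ rule x j s + r / σ j * pulls σ rule x j s := by linarith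
    _ = (gap μ j + 3 * r) / σ j * pulls σ rule x j s := by ring
    _ ≤ _ := by gcongr

end Ratio

/-! ### The deterministic part of the proof -/

section Bounds

variable {k : ℕ} {μ σ : Fin k → ℝ}

lemma gap_best (hk : 2 ≤ k) {b : Fin k} (hb : ∀ i, i ≠ b → μ i < μ b) :
    gap μ b = μ b - second μ b := by
  obtain ⟨l, hl, hsup⟩ := exists_iSup_ne_eq hk μ b
  rw [gap, second, hsup, abs_of_pos (by linarith [hb l hl])]

lemma gap_of_ne_best {b : Fin k} (hb : ∀ i, i ≠ b → μ i < μ b) {i : Fin k} (hi : i ≠ b) :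
    gap μ i = μ b - μ i := by
  rw [gap_eq_of_forall_le hi.symm (fun j _ => ?_), abs_sub_comm, abs_of_pos (by linarith [hb i hi])]
  by_cases hj : j = b
  · rw [hj]
  · exact (hb j hj).le

lemma gap_pos (hk : 2 ≤ k) {b : Fin k} (hb : ∀ i, i ≠ b → μ i < μ b) (i : Fin k) :
    0 < gap μ i := by
  by_cases hi : i = b
  · subst hi
    obtain ⟨l, hl, hsup⟩ := exists_iSup_ne_eq hk μ i
    rw [gap, hsup]
    exact abs_pos.2 (by linarith [hb l hl])
  · rw [gap_of_ne_best hb hi]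
    linarith [hb i hi]

lemma logTerm_nonneg : 0 ≤ logTerm μ σ := le_max_right _ _

lemma rhoLow_le (hk : 2 ≤ k) (hσ : ∀ i, 0 < σ i) {b : Fin k} (hb : ∀ i, i ≠ b → μ i < μ b)
    {i : Fin k} (hi : i ≠ b) {t : ℝ} (ht : 0 < t) (hd : t ^ (-(1 / 4) : ℝ) ≤ gap μ b) :
    rhoLow μ σ i b t ≤
      (gap μ b - t ^ (-(1 / 4) : ℝ)) / σ b * (σ i / (gap μ i + t ^ (-(1 / 4) : ℝ))) := by
  refine (min_le_right _ _).trans ?_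
  rw [rhoLow2, ← gap_best hk hb, ← gap_of_ne_best hb hi]
  have hδ : 0 ≤ t ^ (-(1 / 4) : ℝ) := by positivity
  set δ := t ^ (-(1 / 4) : ℝ)
  have hg := gap_pos hk hb i
  have h1 := hσ i
  have h2 := hσ b
  have hL := logTerm_nonneg (μ := μ) (σ := σ)
  refine mul_le_mul ?_ ?_ (by positivity) (div_nonneg (by linarith) h2.le)
  · refine div_le_div_of_nonneg_left (by linarith) h2 ?_
    refine le_mul_of_one_le_left h2.le ?_
    have : 0 ≤ (t / k) ^ (-(3 / 4) : ℝ) := by positivity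
    linarith
  · have e : σ i / (gap μ i + δ) = ((gap μ i + δ) ^ 2 / σ i ^ 2) ^ (-(1 / 2) : ℝ) := by
      rw [← div_pow, Real.rpow_neg (by positivity), ← Real.sqrt_eq_rpow,
        Real.sqrt_sq (by positivity), inv_div]
    rw [e]
    refine Real.rpow_le_rpow_of_nonpos (by positivity) ?_ (by norm_num)
    have : 0 ≤ 8 * k / √t := by positivity
    have : 0 ≤ 2 * k * logTerm μ σ / t := by positivity
    linarith

lemma le_rhoUp (hk : 2 ≤ k) (hσ : ∀ i, 0 < σ i) {b : Fin k} (hb : ∀ i, i ≠ b → μ i < μ b)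
    {i : Fin k} (hi : i ≠ b) {t : ℝ} (ht : 0 < t) (hd : t ^ (-(1 / 4) : ℝ) < gap μ i) :
    σ i / (gap μ i - t ^ (-(1 / 4) : ℝ)) * ((gap μ b + t ^ (-(1 / 4) : ℝ)) / σ b) ≤
      rhoUp μ σ i b t := by
  refine le_trans ?_ (le_max_left _ _)
  rw [rhoUp1, ← gap_best hk hb, ← gap_of_ne_best hb hi]
  have hδ : 0 ≤ t ^ (-(1 / 4) : ℝ) := by positivity
  set δ := t ^ (-(1 / 4) : ℝ)
  have hg := gap_pos hk hb b
  have h1 := hσ i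
  have h2 := hσ b
  have hL := logTerm_nonneg (μ := μ) (σ := σ)
  have hd' : 0 < gap μ i - δ := by linarith
  refine mul_le_mul ?_ ?_ (by positivity) (by positivity)
  · gcongr
    refine le_mul_of_one_le_left h1.le ?_
    have : 0 ≤ (t / k) ^ (-(3 / 4) : ℝ) := by positivity
    linarith
  · have e : (gap μ b + δ) / σ b = ((gap μ b + δ) ^ 2 / σ b ^ 2) ^ (1 / 2 : ℝ) := by
      rw [← div_pow, ← Real.sqrt_eq_rpow, Real.sqrt_sq (by positivity)]
    rw [e]
    refine Real.rpow_le_rpow (by positivity) ?_ (by norm_num)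
    have : 0 ≤ 8 * k / √t := by positivity
    have : 0 ≤ 2 * k * logTerm μ σ / t := by positivity
    linarith

lemma tendsto_natCast_rpow_neg {a : ℝ} (ha : 0 < a) :
    Tendsto (fun s : ℕ => (s : ℝ) ^ (-a)) atTop (𝓝 0) :=
  (tendsto_rpow_neg_atTop ha).comp tendsto_natCast_atTop_atTop

/-- Linear growth and concentration from time `ε / 2 * s` on
imply all claims about time `s`. -/
lemma eventually_bounds (hk : 2 ≤ k) (hσ : ∀ i, 0 < σ i) {b : Fin k}
    (hb : ∀ i, i ≠ b → μ i < μ b) {ε : ℝ} (hε : 0 < ε) (hε1 : ε ≤ 1) :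
    ∀ᶠ s : ℕ in atTop, ∀ (rule : Knowledge k → Fin k) (x : Fin k → ℕ → ℝ), IsKGRule σ rule →
      Concentrated μ σ rule x s →
      (∀ w : ℕ, ε / 2 * s ≤ w → w ≤ s → ∀ j, ε * w ≤ (pulls σ rule x j w : ℝ)) →
      (∀ i, ((s : ℝ) / k) ^ (3 / 4 : ℝ) ≤ pulls σ rule x i s) ∧
        ∀ i, i ≠ b → rhoLow μ σ i b s ≤ (pulls σ rule x i s : ℝ) / pulls σ rule x b s ∧
          (pulls σ rule x i s : ℝ) / pulls σ rule x b s ≤ rhoUp μ σ i b s := by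
  have : Nonempty (Fin k) := ⟨b⟩
  obtain ⟨i₂, hi₂⟩ := Finite.exists_min (gap μ)
  have hgap := gap_pos hk hb
  filter_upwards [eventually_pulls_ratio hk hσ hgap hε hε1, eventually_gt_atTop 0,
    (tendsto_natCast_rpow_neg (show (0 : ℝ) < 1 / 4 by norm_num)).eventually_lt_const
      (lt_min (hgap i₂) hε)] with s hratio hs hsmall rule x hrule hconc hlin
  have hs0 : (0 : ℝ) < s := by exact_mod_cast hs
  have hk1 : (1 : ℝ) ≤ k := by exact_mod_cast (by omega : 1 ≤ k)
  have hratio := hratio rule x hrule hconc hlin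
  have hlins := hlin s (by nlinarith) le_rfl
  have hδ : 0 ≤ (s : ℝ) ^ (-(1 / 4) : ℝ) := by positivity
  refine ⟨fun i => ?_, fun i hi => ?_⟩
  · refine le_trans ?_ (hlins i)
    calc ((s : ℝ) / k) ^ (3 / 4 : ℝ) ≤ (s : ℝ) ^ (3 / 4 : ℝ) := by
          gcongr
          exact div_le_self hs0.le hk1
      _ = (s : ℝ) ^ (-(1 / 4) : ℝ) * s := by
          rw [← Real.rpow_add_one hs0.ne']; norm_num
      _ ≤ ε * s := by
          gcongr
          exact hsmall.le.trans (min_le_right _ _)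
  · have hlt : ∀ a, (s : ℝ) ^ (-(1 / 4) : ℝ) < gap μ a := fun a =>
      (hsmall.trans_le (min_le_left _ _)).trans_le (hi₂ a)
    have hNb : (0 : ℝ) < pulls σ rule x b s := lt_of_lt_of_le (by positivity) (hlins b)
    have h1 := hratio b i
    have h2 := hratio i b
    have hi0 := hlt i
    have hgi := hgap i
    have hσi := hσ i
    have hσb := hσ b
    constructor
    · refine (rhoLow_le hk hσ hb hi hs0 (hlt b).le).trans ?_
      rw [le_div_iff₀ hNb]
      set δ := (s : ℝ) ^ (-(1 / 4) : ℝ)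
      calc (gap μ b - δ) / σ b * (σ i / (gap μ i + δ)) * pulls σ rule x b s
          = (gap μ b - δ) / σ b * pulls σ rule x b s * (σ i / (gap μ i + δ)) := by ring
        _ ≤ (gap μ i + δ) / σ i * pulls σ rule x i s * (σ i / (gap μ i + δ)) := by gcongr
        _ = pulls σ rule x i s := by field_simp
    · refine le_trans ?_ (le_rhoUp hk hσ hb hi hs0 (hlt i))
      rw [div_le_iff₀ hNb]
      set δ := (s : ℝ) ^ (-(1 / 4) : ℝ)
      have hpos : 0 < gap μ i - δ := by linarith
      calc (pulls σ rule x i s : ℝ)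
          = σ i / (gap μ i - δ) * ((gap μ i - δ) / σ i * pulls σ rule x i s) := by field_simp
        _ ≤ σ i / (gap μ i - δ) * ((gap μ b + δ) / σ b * pulls σ rule x b s) := by gcongr
        _ = _ := by ring

/-! ### The failure probability -/

/-- The failure probabilities at time `s` beat `exp (-K * s ^ (1 / 4))` with a summable factor to
spare. -/
lemma eventually_failure_le {a c K : ℝ} (ha : 0 < a) (hc : 0 < c) (m : ℝ) :
    ∀ᶠ s : ℕ in atTop, m * (s + 1) ^ 2 * Real.exp (-(a * root s ^ 4)) +
      m * Real.exp (-(c * root s ^ 6)) ≤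
        1 / ((s : ℝ) + 1) ^ 2 * Real.exp (-(K * (s : ℝ) ^ (1 / 4 : ℝ))) := by
  have hlim : Tendsto (fun s : ℕ => 32 * |m| * (2 / a) ^ 14 *
      ((a / 2 * root s ^ 4) ^ 14 * Real.exp (-(a / 2 * root s ^ 4)))) atTop (𝓝 0) := by
    have h1 : Tendsto (fun s : ℕ => a / 2 * root s ^ 4) atTop atTop :=
      ((tendsto_pow_atTop (by norm_num)).comp tendsto_root).const_mul_atTop (by positivity)
    simpa using ((Real.tendsto_pow_mul_exp_neg_atTop_nhds_zero 14).comp h1).const_mul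
      (32 * |m| * (2 / a) ^ 14)
  have hK : ∀ᶠ s : ℕ in atTop, K * (s : ℝ) ^ (1 / 4 : ℝ) ≤ a / 2 * root s ^ 4 := by
    have h1 := tendsto_natCast_rpow_neg (show (0 : ℝ) < 1 / 28 by norm_num)
    have h2 := h1.const_mul |K|
    rw [mul_zero] at h2
    filter_upwards [h2.eventually_lt_const (half_pos ha), eventually_gt_atTop 0] with s hs hs0
    have hs0' : (0 : ℝ) < s := by exact_mod_cast hs0
    have e : (s : ℝ) ^ (1 / 4 : ℝ) = (s : ℝ) ^ (-(1 / 28) : ℝ) * root s ^ 4 := by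
      rw [root, ← Real.rpow_natCast, ← Real.rpow_mul hs0'.le, ← Real.rpow_add hs0']
      norm_num
    rw [e, ← mul_assoc]
    have := root_nonneg s
    gcongr
    refine le_trans ?_ hs.le
    gcongr
    exact le_abs_self K
  filter_upwards [hlim.eventually_lt_const one_pos, hK, tendsto_root.eventually_ge_atTop 1,
    eventually_mul_root_pow_le a hc (show 4 < 6 by norm_num), eventually_gt_atTop 0]
    with s h1 h2 hp1 h3 hs0
  have hs1 : (1 : ℝ) ≤ s := by exact_mod_cast hs0
  have hps := root_pow s
  set p := root s
  have hm := abs_nonneg m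
  have hexp : Real.exp (-(c * p ^ 6)) ≤ Real.exp (-(a * p ^ 4)) :=
    Real.exp_le_exp.2 (by linarith)
  have hsq : (1 : ℝ) ≤ (s + 1) ^ 2 := by nlinarith
  have e1 : m * (s + 1) ^ 2 * Real.exp (-(a * p ^ 4)) + m * Real.exp (-(c * p ^ 6)) ≤
      2 * |m| * (s + 1) ^ 2 * Real.exp (-(a * p ^ 4)) := by
    have e2 : m * (s + 1) ^ 2 * Real.exp (-(a * p ^ 4)) ≤
        |m| * (s + 1) ^ 2 * Real.exp (-(a * p ^ 4)) := by gcongr; exact le_abs_self m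
    have e3 : m * Real.exp (-(c * p ^ 6)) ≤ |m| * (s + 1) ^ 2 * Real.exp (-(a * p ^ 4)) := by
      refine mul_le_mul ?_ hexp (Real.exp_nonneg _) (by positivity)
      exact (le_abs_self m).trans (le_mul_of_one_le_right hm hsq)
    linarith
  have e4 : Real.exp (-(a * p ^ 4)) =
      Real.exp (-(a / 2 * p ^ 4)) * Real.exp (-(a / 2 * p ^ 4)) := by
    rw [← Real.exp_add]; ring_nf
  have e5 : 2 * |m| * (s + 1) ^ 4 * Real.exp (-(a / 2 * p ^ 4)) ≤ 1 := by
    refine le_trans ?_ h1.le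
    have e6 : ((s : ℝ) + 1) ^ 4 ≤ (2 * p ^ 14) ^ 4 := by
      gcongr
      rw [hps]; linarith
    have e7 : 32 * |m| * (2 / a) ^ 14 * ((a / 2 * p ^ 4) ^ 14 * Real.exp (-(a / 2 * p ^ 4))) =
        2 * |m| * (2 * p ^ 14) ^ 4 * Real.exp (-(a / 2 * p ^ 4)) := by
      field_simp
      ring
    rw [e7]
    gcongr
  refine e1.trans ?_
  rw [e4, one_div, ← div_eq_inv_mul, le_div_iff₀ (by positivity)]
  calc 2 * |m| * (s + 1) ^ 2 * (Real.exp (-(a / 2 * p ^ 4)) * Real.exp (-(a / 2 * p ^ 4))) *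
        (s + 1) ^ 2
      = 2 * |m| * (s + 1) ^ 4 * Real.exp (-(a / 2 * p ^ 4)) * Real.exp (-(a / 2 * p ^ 4)) := by
        ring
    _ ≤ 1 * Real.exp (-(a / 2 * p ^ 4)) := by gcongr
    _ ≤ Real.exp (-(K * (s : ℝ) ^ (1 / 4 : ℝ))) := by
        rw [one_mul]; exact Real.exp_le_exp.2 (by linarith)

lemma sigmaMax_pos (hσ : ∀ i, 0 < σ i) (b : Fin k) : 0 < sigmaMax σ :=
  (hσ b).trans_le (le_ciSup (Set.finite_range σ).bddAbove b)

lemma q_nonneg (hσ : ∀ i, 0 < σ i) (b : Fin k) {s : ℝ} (hs : 0 ≤ s) : 0 ≤ q σ s := by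
  have := sigmaMax_pos hσ b
  unfold q
  positivity

/-- `q` decays only like `exp (-C * t ^ (1 / 4))`, also if time is changed by a factor `ε`. -/
lemma eventually_le_q (hσ : ∀ i, 0 < σ i) (hk : 0 < k) (b : Fin k) {ε : ℝ} (hε : 0 < ε) (S : ℝ) :
    ∃ K > 0, ∀ᶠ t : ℕ in atTop,
      S * Real.exp (-(K * (ε * t) ^ (1 / 4 : ℝ))) ≤ q σ (3 / 4 * t) := by
  have hM := sigmaMax_pos hσ b
  have hk0 : (0 : ℝ) < k := by exact_mod_cast hk
  set E := (k : ℝ) ^ (1 / 4 : ℝ) * (3 / 4) ^ (1 / 4 : ℝ) / (8 * sigmaMax σ ^ 2) with hE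
  have hE0 : 0 < E := by positivity
  set B := 4 * sigmaMax σ * (k : ℝ) ^ (-(1 / 8) : ℝ) * (3 / 4) ^ (-(1 / 8) : ℝ) with hB
  have hB0 : 0 < B := by positivity
  refine ⟨(E + 1) / ε ^ (1 / 4 : ℝ), by positivity, ?_⟩
  have hlim : Tendsto (fun t : ℕ => S * (((t : ℝ) ^ (1 / 4 : ℝ)) ^ (1 / 2 : ℝ) *
      Real.exp (-1 * (t : ℝ) ^ (1 / 4 : ℝ)))) atTop (𝓝 0) := by
    have h1 : Tendsto (fun t : ℕ => (t : ℝ) ^ (1 / 4 : ℝ)) atTop atTop :=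
      (tendsto_rpow_atTop (by norm_num)).comp tendsto_natCast_atTop_atTop
    simpa using ((tendsto_rpow_mul_exp_neg_mul_atTop_nhds_zero (1 / 2) 1 one_pos).comp
      h1).const_mul S
  filter_upwards [hlim.eventually_lt_const hB0, eventually_gt_atTop 0] with t ht ht0
  have ht0' : (0 : ℝ) < t := by exact_mod_cast ht0
  set z := (t : ℝ) ^ (1 / 4 : ℝ) with hz
  have hz0 : 0 < z := by positivity
  have e1 : (E + 1) / ε ^ (1 / 4 : ℝ) * (ε * t) ^ (1 / 4 : ℝ) = (E + 1) * z := by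
    rw [Real.mul_rpow hε.le ht0'.le, hz]; field_simp
  have e2 : q σ (3 / 4 * t) = B * (z ^ (1 / 2 : ℝ))⁻¹ * Real.exp (-(E * z)) := by
    have h1 : (3 / 4 * (t : ℝ)) ^ (-(1 / 8) : ℝ) =
        (3 / 4) ^ (-(1 / 8) : ℝ) * (z ^ (1 / 2 : ℝ))⁻¹ := by
      rw [Real.mul_rpow (by norm_num) ht0'.le, hz, ← Real.rpow_mul ht0'.le,
        ← Real.rpow_neg ht0'.le]
      norm_num
    have h2 : (3 / 4 * (t : ℝ)) ^ (1 / 4 : ℝ) = (3 / 4) ^ (1 / 4 : ℝ) * z := by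
      rw [Real.mul_rpow (by norm_num) ht0'.le]
    rw [q, h1, h2, hB, hE]
    congr 1
    · ring
    · congr 1; ring
  rw [e1, e2]
  have e3 : Real.exp (-((E + 1) * z)) = Real.exp (-1 * z) * Real.exp (-(E * z)) := by
    rw [← Real.exp_add]; ring_nf
  rw [e3, ← mul_assoc]
  refine mul_le_mul_of_nonneg_right ?_ (Real.exp_nonneg _)
  rw [← div_eq_mul_inv, le_div_iff₀ (by positivity)]
  linarith

lemma tendsto_q (hσ : ∀ i, 0 < σ i) (hk : 0 < k) (b : Fin k) :
    Tendsto (fun t : ℕ => q σ (3 / 4 * t)) atTop (𝓝 0) := by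
  have hM := sigmaMax_pos hσ b
  have hk0 : (0 : ℝ) < k := by exact_mod_cast hk
  have h1 : Tendsto (fun t : ℕ => 3 / 4 * (t : ℝ)) atTop atTop :=
    tendsto_natCast_atTop_atTop.const_mul_atTop (by norm_num)
  have h2 := ((tendsto_rpow_neg_atTop (show (0 : ℝ) < 1 / 8 by norm_num)).comp h1).const_mul
    (4 * sigmaMax σ * (k : ℝ) ^ (-(1 / 8) : ℝ))
  rw [mul_zero] at h2
  refine squeeze_zero (fun t => q_nonneg hσ b (by positivity)) (fun t => ?_) h2
  refine mul_le_of_le_one_right (by positivity) ?_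
  rw [Real.exp_le_one_iff, neg_nonpos]
  positivity

end Bounds

/-! ### The good event -/

section Main

variable {Ω : Type*} [MeasurableSpace Ω] {P : Measure Ω} {k : ℕ}
  {μ σ : Fin k → ℝ} {rule : Knowledge k → Fin k} {X : Fin k → ℕ → Ω → ℝ}

/-- From time `n` on, the trajectory is concentrated and no two arms of equal means stay close. -/
def Good (μ σ : Fin k → ℝ) (rule : Knowledge k → Fin k) (κ C : ℝ) (x : Fin k → ℕ → ℝ)
    (n : ℕ) : Prop :=
  ∀ s, n ≤ s → Concentrated μ σ rule x s ∧
    ∀ i j, i ≠ j → μ i = μ j → ((tiedRounds σ rule κ C x i j s).card : ℝ) < s / (4 * k ^ 2)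

/-- The constant `S` does not depend on the rate `K`, because the failure probabilities decay faster
than `exp (-K * s ^ (1 / 4))` for every `K`. -/
lemma exists_measure_not_good_le [IsProbabilityMeasure P] (hσ : ∀ i, 0 < σ i) (hk : 0 < k)
    (hX : ∀ i n, Measurable (X i n))
    (hlaw : ∀ i n, P.map (X i n) = gaussianReal (μ i) (σ i ^ 2).toNNReal)
    (hindep : iIndepFun (fun p : Fin k × ℕ => X p.1 p.2) P) (hrule : Measurable rule)
    {κ C : ℝ} (hκ : 0 < κ) (hC : 0 < C) :
    ∃ S ≥ 0, ∀ K > 0, ∀ᶠ n : ℕ in atTop,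
      P {ω | ¬ Good μ σ rule κ C (fun i m => X i m ω) n} ≤
        ENNReal.ofReal (S * Real.exp (-(K * (n : ℝ) ^ (1 / 4 : ℝ)))) := by
  have : Nonempty (Fin k) := ⟨⟨0, hk⟩⟩
  obtain ⟨i₁, hi₁⟩ := Finite.exists_max σ
  have hhi : 0 < σ i₁ := hσ _
  obtain ⟨c, hc, htied⟩ := exists_measure_tied_le hσ hk hX hlaw hindep hrule hκ hC
  have hsummable : Summable fun s : ℕ => 1 / ((s : ℝ) + 1) ^ 2 := by
    have := (summable_nat_add_iff 1).2 (Real.summable_one_div_nat_pow.2 (show 1 < 2 by norm_num))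
    exact_mod_cast this
  refine ⟨∑' s : ℕ, 1 / ((s : ℝ) + 1) ^ 2, tsum_nonneg fun s => by positivity, fun K hK => ?_⟩
  have hk0 : (0 : ℝ) < k := by exact_mod_cast hk
  have hev := htied.and (eventually_failure_le (a := 1 / (2 * σ i₁ ^ 2)) (c := c) (K := K)
    (by positivity) hc (2 * k + k ^ 2))
  rw [eventually_atTop] at hev
  obtain ⟨n₀, hn₀⟩ := hev
  filter_upwards [eventually_ge_atTop n₀] with n hn
  set A : ℕ → Set Ω := fun s => {ω | ¬ Concentrated μ σ rule (fun i m => X i m ω) s}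
  set T : ℕ → Fin k × Fin k → Set Ω := fun s p => {ω | (p.1 ≠ p.2 ∧ μ p.1 = μ p.2) ∧
    Concentrated μ σ rule (fun i m => X i m ω) s ∧
      (s : ℝ) / (4 * k ^ 2) ≤ (tiedRounds σ rule κ C (fun i m => X i m ω) p.1 p.2 s).card}
  set F : ℕ → Set Ω := fun s => if n ≤ s then A s ∪ ⋃ p ∈ Finset.univ, T s p else ∅
  have hsub : {ω | ¬ Good μ σ rule κ C (fun i m => X i m ω) n} ⊆ ⋃ s, F s := by
    intro ω hω
    simp only [Good, Set.mem_ofPred_eq] at hω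
    push Not at hω
    obtain ⟨s, hs, h⟩ := hω
    refine Set.mem_iUnion.2 ⟨s, ?_⟩
    simp only [F, if_pos hs]
    by_cases hconc : Concentrated μ σ rule (fun i m => X i m ω) s
    · obtain ⟨i, j, hij, hμ, hcard⟩ := h hconc
      refine Or.inr (Set.mem_iUnion₂.2 ⟨(i, j), Finset.mem_univ _, ⟨hij, hμ⟩, hconc, hcard⟩)
    · exact Or.inl hconc
  have hT : ∀ s, n ≤ s → ∀ p, P (T s p) ≤ ENNReal.ofReal (Real.exp (-(c * root s ^ 6))) := by
    intro s hs p
    by_cases hp : p.1 ≠ p.2 ∧ μ p.1 = μ p.2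
    · exact (measure_mono fun ω hω => hω.2).trans ((hn₀ s (hn.trans hs)).1 p.1 p.2 hp.1 hp.2)
    · have : T s p = ∅ := by
        ext ω
        exact ⟨fun h => absurd h.1 hp, fun h => h.elim⟩
      rw [this]; simp
  have hF : ∀ s, P (F s) ≤ ENNReal.ofReal (1 / ((s : ℝ) + 1) ^ 2 *
      Real.exp (-(K * (n : ℝ) ^ (1 / 4 : ℝ)))) := by
    intro s
    by_cases hs : n ≤ s
    · simp only [F, if_pos hs]
      have h1 := measure_not_concentrated_le hσ hi₁ hX hlaw hindep hrule s
      have h2 : P (⋃ p ∈ Finset.univ, T s p) ≤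
          ENNReal.ofReal (k ^ 2 * Real.exp (-(c * root s ^ 6))) := by
        calc P (⋃ p ∈ Finset.univ, T s p) ≤ ∑ p, P (T s p) := measure_biUnion_finset_le _ _
          _ ≤ ∑ _p : Fin k × Fin k, ENNReal.ofReal (Real.exp (-(c * root s ^ 6))) :=
              Finset.sum_le_sum fun p _ => hT s hs p
          _ = _ := by
              rw [Finset.sum_const, nsmul_eq_mul, ← ENNReal.ofReal_natCast,
                ← ENNReal.ofReal_mul (Nat.cast_nonneg _)]
              congr 2
              simp [pow_two]
      refine (measure_union_le _ _).trans ((add_le_add h1 h2).trans ?_)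
      rw [← ENNReal.ofReal_add (by positivity) (by positivity)]
      refine ENNReal.ofReal_le_ofReal (le_trans (add_le_add ?_ ?_)
        (((hn₀ s (hn.trans hs)).2).trans ?_))
      · rw [show root s ^ 4 / (2 * σ i₁ ^ 2) = 1 / (2 * σ i₁ ^ 2) * root s ^ 4 by ring]
        gcongr
        nlinarith
      · gcongr
        nlinarith
      · gcongr
    · simp [F, hs]
  calc _ ≤ P (⋃ s, F s) := measure_mono hsub
    _ ≤ ∑' s, P (F s) := measure_iUnion_le _
    _ ≤ ∑' s : ℕ, ENNReal.ofReal (1 / ((s : ℝ) + 1) ^ 2 *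
          Real.exp (-(K * (n : ℝ) ^ (1 / 4 : ℝ)))) := ENNReal.tsum_le_tsum hF
    _ = _ := by
        rw [← ENNReal.ofReal_tsum_of_nonneg (fun s => by positivity) (hsummable.mul_right _),
          tsum_mul_right]

end Main

end KnowledgeGradient

open Filter KnowledgeGradient in
theorem proposition2 {Ω : Type*} [MeasurableSpace Ω] (P : Measure Ω) [IsProbabilityMeasure P]
    (k : ℕ) (hk : 2 ≤ k) (μ σ : Fin k → ℝ) (hσ : ∀ i, 0 < σ i)
    (b : Fin k) (hb : ∀ i, i ≠ b → μ i < μ b)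
    (X : Fin k → ℕ → Ω → ℝ) (hX : ∀ i n, Measurable (X i n))
    (hlaw : ∀ i n, P.map (X i n) = gaussianReal (μ i) (σ i ^ 2).toNNReal)
    (hindep : iIndepFun (fun p : Fin k × ℕ => X p.1 p.2) P)
    (rule : KnowledgeGradient.Knowledge k → Fin k) (hrule : KnowledgeGradient.IsKGRule σ rule)
    (N : Fin k → ℕ → Ω → ℕ)
    (hN : ∀ i t ω, N i t ω = KnowledgeGradient.pulls σ rule (fun j n => X j n ω) i t) :
    ∃ T : ℕ, ∀ t : ℕ, T < t →
      (1 - KnowledgeGradient.q σ (3 / 4 * (t : ℝ))) ^ k ≤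
        P.real {ω | ∀ s : ℕ, t ≤ s →
          (∀ i, ((s : ℝ) / k) ^ (3 / 4 : ℝ) ≤ N i s ω) ∧
          ∀ i, i ≠ b →
            KnowledgeGradient.rhoLow μ σ i b s ≤ (N i s ω : ℝ) / N b s ω ∧
            (N i s ω : ℝ) / N b s ω ≤ KnowledgeGradient.rhoUp μ σ i b s} := by
  have hk0 : 0 < k := by omega
  obtain ⟨κ, hκ, C, hC, ε', hε', hgrow'⟩ := exists_linear_growth hk hσ hb
  set ε := min ε' 1
  have hε : 0 < ε := lt_min hε' one_pos
  have hε1 : ε ≤ 1 := min_le_right _ _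
  obtain ⟨s₀, hgrow⟩ := eventually_atTop.1 hgrow'
  obtain ⟨s₁, hbounds⟩ := eventually_atTop.1 (eventually_bounds hk hσ hb hε hε1)
  obtain ⟨S, hS0, hS⟩ := exists_measure_not_good_le hσ hk0 hX hlaw hindep hrule.1 hκ hC
  obtain ⟨K, hK, hqK⟩ := eventually_le_q hσ hk0 b (half_pos hε) S
  -- claims about times `s ≥ t` use the trajectory from time `ε / 2 * t` on
  set n : ℕ → ℕ := fun t => ⌈ε / 2 * (t : ℝ)⌉₊ with hn
  have hn_tendsto : Tendsto n atTop atTop := tendsto_nat_ceil_atTop.comp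
    (tendsto_natCast_atTop_atTop.const_mul_atTop (half_pos hε))
  have hev : ∀ᶠ t : ℕ in atTop, s₀ ≤ n t ∧ s₁ ≤ t ∧ q σ (3 / 4 * t) < 1 ∧
      S * Real.exp (-(K * (ε / 2 * t) ^ (1 / 4 : ℝ))) ≤ q σ (3 / 4 * t) ∧
      P {ω | ¬ Good μ σ rule κ C (fun i m => X i m ω) (n t)} ≤
        ENNReal.ofReal (S * Real.exp (-(K * (n t : ℝ) ^ (1 / 4 : ℝ)))) := by
    filter_upwards [hn_tendsto.eventually_ge_atTop s₀, eventually_ge_atTop s₁,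
      (tendsto_q hσ hk0 b).eventually_lt_const one_pos, hqK, hn_tendsto.eventually (hS K hK)]
      with t h1 h2 h3 h4 h5
    exact ⟨h1, h2, h3, h4, h5⟩
  obtain ⟨T, hT⟩ := eventually_atTop.1 hev
  refine ⟨T, fun t ht => ?_⟩
  obtain ⟨h1, h2, h3, h4, h5⟩ := hT t ht.le
  have hq0 : 0 ≤ q σ (3 / 4 * t) := q_nonneg hσ b (by positivity)
  set good := {ω | Good μ σ rule κ C (fun i m => X i m ω) (n t)}
  have hbad : P.real goodᶜ ≤ q σ (3 / 4 * t) := by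
    refine ENNReal.toReal_le_of_le_ofReal hq0 (h5.trans (ENNReal.ofReal_le_ofReal ?_))
    refine le_trans ?_ h4
    gcongr
    exact Nat.le_ceil _
  have hsum : 1 ≤ P.real good + P.real goodᶜ := by
    have := measureReal_union_le (μ := P) good goodᶜ
    rwa [Set.union_compl_self, probReal_univ] at this
  calc (1 - q σ (3 / 4 * t)) ^ k ≤ 1 - q σ (3 / 4 * t) :=
        pow_le_of_le_one (by linarith) (by linarith) hk0.ne'
    _ ≤ P.real good := by linarith
    _ ≤ _ := by
      refine measureReal_mono fun ω hω s hs => ?_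
      have hω : Good μ σ rule κ C (fun i m => X i m ω) (n t) := hω
      have hts : (t : ℝ) ≤ s := by exact_mod_cast hs
      have hnw : ∀ w : ℕ, ε / 2 * s ≤ w → n t ≤ w := fun w hw =>
        Nat.ceil_le.2 (le_trans (by gcongr) hw)
      have hns : n t ≤ s := hnw s (by nlinarith [Nat.cast_nonneg (α := ℝ) s])
      simp only [hN]
      refine hbounds s (h2.trans hs) rule _ hrule (hω s hns).1 fun w hw _ j => ?_
      have hg := hgrow w (h1.trans (hnw w hw)) rule _ hrule (hω w (hnw w hw)).1
        (hω w (hnw w hw)).2 j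
      refine le_trans ?_ hg
      gcongr
      exact min_le_left _ _
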